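/- Let $R$ be a commutative local ring with residue field $k$, let $\mathbf{D}(R)$ be the unbounded derived category of $R$-modules, and let $\mathbf{D}(R)^c$ be its full subcategory of compact objects. Definitions. For a local ring $(A,\mathfrak{m})$ define the transfinite powers of $\mathfrak{m}$ as follows: $\mathfrak{m}^n$ is the usual power for $n<\omega$; $\mathfrak{m}^\lambda=\bigcap_{\beta<\lambda}\mathfrak{m}^\beta$ for a limit ordinal $\lambda$; and $\mathfrak{m}^{\lambda+n}=(\mathfrak{m}^\lambda)^n$ for a limit ordinal $\lambda$ and $1\le n<\omega$. The ring $A$ is *transfinitely separated* if $\mathfrak{m}^\alpha=0$ for some ordinal $\alpha$. A *definable $\otimes$-ideal* of $\mathbf{D}(R)$ is a thick subcategory $\mathcal{D}$ such that $X\otimes_R^{\mathbf{L}}Y\in\mathcal{D}$ for all $X\in\mathbf{D}(R)$ and $Y\in\mathcal{D}$, and such that $\mathcal{D}=\{X\mid \operatorname{Hom}_{\mathbf{D}(R)}(f,X)=0\ \forall f\in\Phi\}$ for some set $\Phi$ of morphisms of $\mathbf{D}(R)^c$. It is *compactly generated* if $\mathcal{D}=\{X\mid \operatorname{Hom}_{\mathbf{D}(R)}(s,\Sigma^iX)=0\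 \forall s\in\mathcal{S},\ i\in\mathbb{Z}\}$ for some thick $\otimes$-ideal $\mathcal{S}$ of $\mathbf{D}(R)^c$. It is *closed under cohomology* if $X\in\mathcal{D}$ implies $\bigoplus_{n\in\mathbb{Z}}H^n(X)\in\mathcal{D}$. The category $\mathbf{D}(R)$ satisfies the *Telescope Conjecture* (TC) if every definable $\otimes$-ideal of $\mathbf{D}(R)$ is compactly generated, and the *Restricted Telescope Conjecture* (RTC) if every definable $\otimes$-ideal of $\mathbf{D}(R)$ that is closed under cohomology is compactly generated. Finally, $\langle k\rangle^{\mathrm{def}}$ is the smallest definable $\otimes$-ideal of $\mathbf{D}(R)$ containing $k$, viewed as a complex concentrated in degree $0$. Lemma. Let $I$ be a proper finitely generated ideal of $R$ such that the local ring $R/I$ is not transfinitely separated. Then $\langle k\rangle^{\mathrm{def}}\neq\mathbf{D}(R)$, and $\mathbf{D}(R)$ fails (TC). If, moreover, $I$ is a principal ideal generated by a non-zerodivisor of $R$, then $\mathbf{D}(R)$ fails (RTC). -/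

import Mathlib

open CategoryTheory CategoryTheory.Limits CategoryTheory.Pretriangulated

universe w v u

noncomputable section

namespace Telescope

/-! ### Transfinite powers of an ideal and transfinitely separated local rings -/

section TransfinitePowers

variable {R : Type u} [CommRing R]

/-- The transfinite power `m ^ α`. Every ordinal is uniquely `α = l + n` with `l` zero or a limit
ordinal and `n` finite; here `l = ω * (α / ω)` and `n = α % ω`. Then
* `m ^ α` is the usual power if `α = n` is finite (for `n = 0` it is the empty intersection `R`);
* `m ^ l = ⋂ β < l, m ^ β` for a limit ordinal `l`;
* `m ^ (l + n) = (m ^ l) ^ n` for a limit ordinal `l` and `1 ≤ n < ω`.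
See the three lemmas `transfinitePow_natCast`, `transfinitePow_of_isSuccLimit` and
`transfinitePow_add_natCast` below. -/
def transfinitePow (m : Ideal R) (α : Ordinal.{v}) : Ideal R :=
  if _hn : α % Ordinal.omega0 = 0 then
    ⨅ β : Set.Iio α, transfinitePow m β.1
  else if _hl : α / Ordinal.omega0 = 0 then
    m ^ Cardinal.toNat (α % Ordinal.omega0).card
  else
    transfinitePow m (Ordinal.omega0 * (α / Ordinal.omega0)) ^
      Cardinal.toNat (α % Ordinal.omega0).card
termination_by α
decreasing_by
  · exact β.2
  · have h := Ordinal.div_add_mod α Ordinal.omega0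
    calc Ordinal.omega0 * (α / Ordinal.omega0)
        < Ordinal.omega0 * (α / Ordinal.omega0) + α % Ordinal.omega0 := by
          simpa using pos_iff_ne_zero.mpr _hn
      _ = α := h

theorem transfinitePow_natCast (m : Ideal R) (n : ℕ) :
    transfinitePow m (n : Ordinal.{v}) = m ^ n := by
  have h1 : (n : Ordinal.{v}) % Ordinal.omega0 = n :=
    Ordinal.mod_eq_of_lt (Ordinal.natCast_lt_omega0 n)
  have h2 : (n : Ordinal.{v}) / Ordinal.omega0 = 0 :=
    Ordinal.div_eq_zero_of_lt (Ordinal.natCast_lt_omega0 n)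
  rw [transfinitePow]
  rcases Nat.eq_zero_or_pos n with rfl | hn
  · simp
  · have h3 : ¬ (n : Ordinal.{v}) % Ordinal.omega0 = 0 := by
      rw [h1]; exact_mod_cast hn.ne'
    rw [dif_neg h3, dif_pos h2, h1]
    simp

theorem transfinitePow_of_isSuccLimit (m : Ideal R) {l : Ordinal.{v}} (hl : Order.IsSuccLimit l) :
    transfinitePow m l = ⨅ β : Set.Iio l, transfinitePow m β.1 := by
  have h : l % Ordinal.omega0 = 0 :=
    Ordinal.mod_eq_zero_of_dvd (Ordinal.isSuccPrelimit_iff_omega0_dvd.mp hl.isSuccPrelimit)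
  rw [transfinitePow, dif_pos h]

theorem transfinitePow_add_natCast (m : Ideal R) {l : Ordinal.{v}} (hl : Order.IsSuccLimit l)
    {n : ℕ} (hn : n ≠ 0) :
    transfinitePow m (l + n) = transfinitePow m l ^ n := by
  obtain ⟨c, rfl⟩ := Ordinal.isSuccPrelimit_iff_omega0_dvd.mp hl.isSuccPrelimit
  have h1 : (Ordinal.omega0 * c + n) % Ordinal.omega0 = (n : Ordinal.{v}) := by
    rw [Ordinal.mul_add_mod_self, Ordinal.mod_eq_of_lt (Ordinal.natCast_lt_omega0 n)]
  have h2 : (Ordinal.omega0 * c + n) / Ordinal.omega0 = c := by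
    rw [Ordinal.mul_add_div _ Ordinal.omega0_ne_zero,
      Ordinal.div_eq_zero_of_lt (Ordinal.natCast_lt_omega0 n), add_zero]
  have hc : c ≠ 0 := by
    rintro rfl
    exact hl.ne_bot (by simp)
  have h3 : ¬ (Ordinal.omega0 * c + n) % Ordinal.omega0 = 0 := by
    rw [h1]; exact_mod_cast hn
  rw [transfinitePow, dif_neg h3, dif_neg (by rw [h2]; exact hc), h1, h2]
  simp

variable (R) in
/-- A local ring `(R, m)` is transfinitely separated if `m ^ α = 0` for some ordinal `α`.
(The powers decrease along limit ordinals, and there are at most `2 ^ |R|` ideals, so ordinals in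
the universe of `R` exhaust all possible values.) -/
def IsTransfinitelySeparated [IsLocalRing R] : Prop :=
  ∃ α : Ordinal.{u}, transfinitePow (IsLocalRing.maximalIdeal R) α = ⊥

end TransfinitePowers

/-! ### Subcategories of a triangulated category -/

section Triangulated

variable {T : Type u} [Category.{v} T] [Preadditive T]

open Classical in
/-- An object `K` is compact if, for every coproduct `c = ∐ X j` of a family indexed by a set, the
canonical map `⨁ j, Hom (K, X j) → Hom (K, ∐ X j)` is an isomorphism. The index sets range over
the universe `w`. -/
def IsCompactObject (K : T) : Prop :=
  ∀ (J : Type w) (X : J → T) (c : Cofan X), IsColimit c →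
    Function.Bijective
      (DirectSum.toAddMonoid (fun j => Preadditive.rightComp K (c.inj j)) :
        DirectSum J (fun j => K ⟶ X j) →+ (K ⟶ c.pt))

/-- A full subcategory is definable if it consists of the objects `X` such that `Hom (f, X) = 0`
for all `f` in some collection `Φ` of morphisms between compact objects. (In a compactly generated
category the compact objects are skeletally small, so collections and sets `Φ` give the same.) -/
def IsDefinable (D : ObjectProperty T) : Prop :=
  ∃ Φ : MorphismProperty T,
    (∀ ⦃A B : T⦄ (f : A ⟶ B), Φ f → IsCompactObject.{w} A ∧ IsCompactObject.{w} B) ∧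
    ∀ X : T, D X ↔ ∀ ⦃A B : T⦄ (f : A ⟶ B), Φ f → ∀ g : B ⟶ X, f ≫ g = 0

variable [HasZeroObject T] [HasShift T ℤ] [∀ n : ℤ, (shiftFunctor T n).Additive]
  [Pretriangulated T]

/-- A thick subcategory: a triangulated subcategory closed under direct summands (in particular,
under isomorphisms). -/
structure IsThick (D : ObjectProperty T) : Prop where
  isTriangulated : D.IsTriangulated
  isStableUnderRetracts : D.IsStableUnderRetracts

/-- `S^⊥`, the objects `X` with `Hom (s, Σ^i X) = 0` for all `s` in `S` and all integers `i`. -/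
def perp (S : ObjectProperty T) : ObjectProperty T :=
  fun X => ∀ ⦃s : T⦄, S s → ∀ (i : ℤ) (f : s ⟶ X⟦i⟧), f = 0

end Triangulated

/-! ### The derived category of a commutative ring -/

section Derived

variable {R : Type u} [CommRing R] [HasDerivedCategory.{w} (ModuleCat.{u} R)]

/-- `Z` is (isomorphic to) the derived tensor product `X ⊗ᴸ Y` in `D(R)`: it is represented by the
total tensor product of complexes `P ⊗ M`, where the complex `M` represents `Y` and the K-projective
complex `P` represents `X`. -/
def IsDerivedTensor (X Y Z : DerivedCategory (ModuleCat.{u} R)) : Prop :=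
  ∃ P M : CochainComplex (ModuleCat.{u} R) ℤ, P.IsKProjective ∧
    Nonempty (DerivedCategory.Q.obj P ≅ X) ∧ Nonempty (DerivedCategory.Q.obj M ≅ Y) ∧
    Nonempty (DerivedCategory.Q.obj (HomologicalComplex.tensorObj P M) ≅ Z)

/-- A definable `⊗`-ideal of `D(R)`: a thick subcategory, closed under `X ⊗ᴸ -` for every object
`X` of `D(R)`, which is definable. -/
structure IsDefinableTensorIdeal (D : ObjectProperty (DerivedCategory (ModuleCat.{u} R))) :
    Prop where
  isThick : IsThick D
  tensor_mem : ∀ ⦃X Y Z : DerivedCategory (ModuleCat.{u} R)⦄, D Y → IsDerivedTensor X Y Z → D Z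
  isDefinable : IsDefinable.{u} D

/-- A thick `⊗`-ideal of the category `D(R)^c` of compact objects of `D(R)`. -/
structure IsThickTensorIdealOfCompacts
    (S : ObjectProperty (DerivedCategory (ModuleCat.{u} R))) : Prop where
  isCompactObject : ∀ ⦃X⦄, S X → IsCompactObject.{u} X
  isThick : IsThick S
  tensor_mem : ∀ ⦃X Y Z : DerivedCategory (ModuleCat.{u} R)⦄, IsCompactObject.{u} X → S Y →
    IsDerivedTensor X Y Z → S Z

/-- A subcategory of `D(R)` is compactly generated (as a definable `⊗`-ideal) if it is `S^⊥` for a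
thick `⊗`-ideal `S` of `D(R)^c`. -/
def IsCompactlyGenerated (D : ObjectProperty (DerivedCategory (ModuleCat.{u} R))) : Prop :=
  ∃ S : ObjectProperty (DerivedCategory (ModuleCat.{u} R)),
    IsThickTensorIdealOfCompacts S ∧ D = perp S

/-- A subcategory `D` of `D(R)` is closed under cohomology if `X ∈ D` implies that the module
`H^*(X) = ⨁ n, H^n(X)`, viewed as a complex in degree `0`, belongs to `D`. -/
def IsClosedUnderCohomology (D : ObjectProperty (DerivedCategory (ModuleCat.{u} R))) : Prop :=
  ∀ X, D X → D ((DerivedCategory.singleFunctor (ModuleCat.{u} R) 0).obj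
    (∐ fun n : ℤ => (DerivedCategory.homologyFunctor (ModuleCat.{u} R) n).obj X))

/-- `⟨C⟩^def`, the smallest definable `⊗`-ideal of `D(R)` containing `C`, constructed as the
intersection of all of them (see `isDefinableTensorIdeal_definableClosure`). -/
def definableClosure (C : ObjectProperty (DerivedCategory (ModuleCat.{u} R))) :
    ObjectProperty (DerivedCategory (ModuleCat.{u} R)) :=
  fun X => ∀ D : ObjectProperty (DerivedCategory (ModuleCat.{u} R)),
    IsDefinableTensorIdeal D → C ≤ D → D X

theorem le_definableClosure (C : ObjectProperty (DerivedCategory (ModuleCat.{u} R))) :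
    C ≤ definableClosure C :=
  fun _ hX _ _ hCD => hCD _ hX

theorem definableClosure_le {C D : ObjectProperty (DerivedCategory (ModuleCat.{u} R))}
    (hD : IsDefinableTensorIdeal D) (hCD : C ≤ D) : definableClosure C ≤ D :=
  fun _ hX => hX D hD hCD

theorem isDefinableTensorIdeal_definableClosure
    (C : ObjectProperty (DerivedCategory (ModuleCat.{u} R))) :
    IsDefinableTensorIdeal (definableClosure C) where
  isThick := by
    have hr : (definableClosure C).IsStableUnderRetracts :=
      ⟨fun r hY D hD hCD => by
        have := hD.isThick.isStableUnderRetracts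
        exact D.prop_of_retract r (hY D hD hCD)⟩
    refine ⟨?_, hr⟩
    exact
      { exists_zero := ⟨_, isZero_zero _, fun D hD _ => by
          have := hD.isThick.isStableUnderRetracts
          have := hD.isThick.isTriangulated
          exact D.prop_zero⟩
        isStableUnderShiftBy := fun n => ⟨fun X hX D hD hCD => by
          have := hD.isThick.isTriangulated
          exact D.le_shift n _ (hX D hD hCD)⟩
        ext₂' := fun A hA h₁ h₃ => ObjectProperty.le_isoClosure _ _ fun D hD hCD => by
          have := hD.isThick.isStableUnderRetracts
          have := hD.isThick.isTriangulated
          exact D.ext_of_isTriangulatedClosed₂ A hA (h₁ D hD hCD) (h₃ D hD hCD) }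
  tensor_mem := fun _ _ _ hY h D hD hCD => hD.tensor_mem (hY D hD hCD) h
  isDefinable := by
    refine ⟨fun A B f => IsCompactObject.{u} A ∧ IsCompactObject.{u} B ∧
      ∀ X, definableClosure C X → ∀ g : B ⟶ X, f ≫ g = 0, fun A B f hf => ⟨hf.1, hf.2.1⟩,
      fun X => ⟨fun hX A B f hf g => hf.2.2 X hX g, fun hX D hD hCD => ?_⟩⟩
    obtain ⟨Φ, hΦ, hDΦ⟩ := hD.isDefinable
    rw [hDΦ]
    exact fun A B f hf g => hX f ⟨(hΦ f hf).1, (hΦ f hf).2,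
      fun Y hY g' => (hDΦ Y).1 (hY D hD hCD) f hf g'⟩ g

variable (R) in
/-- The residue field `k` of a local ring, as a complex in degree `0`. -/
def residueFieldObject [IsLocalRing R] : DerivedCategory (ModuleCat.{u} R) :=
  (DerivedCategory.singleFunctor (ModuleCat.{u} R) 0).obj
    (ModuleCat.of R (IsLocalRing.ResidueField R))

variable (R) in
/-- The Telescope Conjecture (TC) for `D(R)`: every definable `⊗`-ideal is compactly generated. -/
def TelescopeConjecture : Prop :=
  ∀ D : ObjectProperty (DerivedCategory (ModuleCat.{u} R)),
    IsDefinableTensorIdeal D → IsCompactlyGenerated D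

variable (R) in
/-- The Restricted Telescope Conjecture (RTC) for `D(R)`: every definable `⊗`-ideal which is closed
under cohomology is compactly generated. -/
def RestrictedTelescopeConjecture : Prop :=
  ∀ D : ObjectProperty (DerivedCategory (ModuleCat.{u} R)),
    IsDefinableTensorIdeal D → IsClosedUnderCohomology D → IsCompactlyGenerated D

end Derived

end Telescope

end

/-! A single subcategory witnesses every claim. The powers of the maximal ideal of `R ⧸ I` at two
different limit ordinals must coincide, and if no power is zero their common value is a nonzero
idempotent ideal. Its preimage `J` in `R` satisfies `J ≤ m`, `¬ J ≤ I` and `J ≤ J ^ 2 ⊔ I`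
(`exists_ideal_of_not_isTransfinitelySeparated`). Let `K` be a Koszul complex on generators of `I`:
a compact object whose identity has annihilator exactly `I` (`exists_isKoszul`). The witness is
`homAnnihilated K J`, the objects `X` such that `J` annihilates every morphism `K⟦n⟧ ⟶ X`.

It is definable, contains `k` because `J ≤ m`, and omits `K` because `¬ J ≤ I`. In an extension of
two of its objects, morphisms from `K⟦n⟧` are annihilated by `J ^ 2`, and always by `I`, hence by
`J`. For closure under `P ⊗ -` with `P` K-projective, cones over coproducts of cells are taken
repeatedly, starting from `P`. The transition maps vanish on homology, so a morphism from a compact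
object to `P ⊗ M` dies after some number `N` of steps. If `M` lies in the subcategory, so does the
cone of each step, so `J ^ N` annihilates the morphism, and iterating `J ≤ J ^ 2 ⊔ I` removes the
exponent (`homAnnihilated_tensor`).

On the other hand, a compactly generated subcategory `S^⊥` containing `k` is everything: a compact
object with no nonzero morphism to a shift of `k` is zero
(`IsCompactObject.isZero_of_residueField`). This is Nakayama's lemma for the top cohomology, which
is finitely generated because compact objects are built from cells
(`IsCompactObject.mem_of_cell_mem`).

For `I = (x)` one takes for `K` the cone of `x` on `R`. Long exact sequences then turn membership of
`X` into a condition on each module `H^n(X)`: every `r ∈ J` kills the `x`-torsion and maps the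
module into its multiples of `x`. This passes to direct sums, so the subcategory is closed under
cohomology. -/

noncomputable section

namespace Telescope

/-! ### Compact objects through finite sums of morphisms -/

section CompactObjects

variable {T : Type u} [Category.{v} T] [Preadditive T]

section Projections

variable {J : Type w} {X : J → T} {c : Cofan X} (hc : IsColimit c)

open Classical in
/-- The projection from a coproduct in a preadditive category to one of the summands. -/
def coproductProj (j : J) : c.pt ⟶ X j :=
  Cofan.IsColimit.desc hc (fun i => if h : i = j then eqToHom (by rw [h]) else 0)

@[simp]
lemma inj_coproductProj_self (j : J) : c.inj j ≫ coproductProj hc j = 𝟙 (X j) := by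
  simp [coproductProj]

@[simp]
lemma inj_coproductProj_self_assoc (j : J) {Z : T} (g : X j ⟶ Z) :
    c.inj j ≫ coproductProj hc j ≫ g = g := by
  rw [← Category.assoc, inj_coproductProj_self, Category.id_comp]

lemma inj_coproductProj_of_ne {i j : J} (h : i ≠ j) : c.inj i ≫ coproductProj hc j = 0 := by
  simp [coproductProj, h]

lemma inj_coproductProj_of_ne_assoc {i j : J} (h : i ≠ j) {Z : T} (g : X j ⟶ Z) :
    c.inj i ≫ coproductProj hc j ≫ g = 0 := by
  rw [← Category.assoc, inj_coproductProj_of_ne hc h, zero_comp]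

lemma sum_comp_coproductProj {K : T} (F : Finset J) (g : ∀ j, K ⟶ X j) {i : J} (hi : i ∈ F) :
    (∑ j ∈ F, g j ≫ c.inj j) ≫ coproductProj hc i = g i := by
  rw [Preadditive.sum_comp, Finset.sum_eq_single_of_mem i hi]
  · simp
  · intro j _ hj
    rw [Category.assoc, inj_coproductProj_of_ne hc hj, comp_zero]

lemma sum_comp_coproductProj_of_notMem {K : T} (F : Finset J) (g : ∀ j, K ⟶ X j) {i : J}
    (hi : i ∉ F) :
    (∑ j ∈ F, g j ≫ c.inj j) ≫ coproductProj hc i = 0 := by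
  rw [Preadditive.sum_comp]
  refine Finset.sum_eq_zero fun j hj => ?_
  rw [Category.assoc, inj_coproductProj_of_ne hc (by rintro rfl; exact hi hj), comp_zero]

end Projections

lemma exists_sum_add {K : T} {J : Type w} {X : J → T} {c : Cofan X} {f f' : K ⟶ c.pt}
    (hf : ∃ (F : Finset J) (g : ∀ j, K ⟶ X j), f = ∑ j ∈ F, g j ≫ c.inj j)
    (hf' : ∃ (F : Finset J) (g : ∀ j, K ⟶ X j), f' = ∑ j ∈ F, g j ≫ c.inj j) :
    ∃ (F : Finset J) (g : ∀ j, K ⟶ X j), f + f' = ∑ j ∈ F, g j ≫ c.inj j := by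
  classical
  obtain ⟨F, g, hF⟩ := hf
  obtain ⟨F', g', hF'⟩ := hf'
  refine ⟨F ∪ F', fun j => (if j ∈ F then g j else 0) + (if j ∈ F' then g' j else 0), ?_⟩
  rw [hF, hF']
  simp only [Preadditive.add_comp, Finset.sum_add_distrib]
  congr 1
  · rw [← Finset.sum_subset (Finset.subset_union_left (s₂ := F'))]
    · exact Finset.sum_congr rfl fun j hj => by simp [hj]
    · intro j _ hj; simp [hj]
  · rw [← Finset.sum_subset (Finset.subset_union_right (s₁ := F))]
    · exact Finset.sum_congr rfl fun j hj => by simp [hj]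
    · intro j _ hj; simp [hj]

/-- The image of a coproduct cofan under a functor preserving this coproduct. -/
def isColimitMapCofan {T' : Type*} [Category T'] (F : T ⥤ T') {J : Type*} {X : J → T}
    [PreservesColimit (Discrete.functor X) F] {c : Cofan X} (hc : IsColimit c) :
    IsColimit (Cofan.mk (F.obj c.pt) (fun j => F.map (c.inj j))) :=
  isColimitMapCoconeCofanMkEquiv _ _ _ (isColimitOfPreserves F
    (IsColimit.ofIsoColimit hc (Cofan.ext (Iso.refl _) (by simp))))

/-- An object is compact as soon as all morphisms to coproducts are finite sums. -/
lemma isCompactObject_of_exists_sum {K : T}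
    (h : ∀ (J : Type w) (X : J → T) (c : Cofan X), IsColimit c → ∀ f : K ⟶ c.pt,
      ∃ (F : Finset J) (g : ∀ j, K ⟶ X j), f = ∑ j ∈ F, g j ≫ c.inj j) :
    IsCompactObject.{w} K := by
  classical
  intro J X c hc
  -- Coordinates are recovered by the projections, which exist in any preadditive category; so
  -- injectivity is automatic and only the finite sums carry content.
  have key : ∀ z : DirectSum J (fun j => K ⟶ X j), ∀ i,
      (DirectSum.toAddMonoid (fun j => Preadditive.rightComp K (c.inj j)) z) ≫
        coproductProj hc i = z i := by
    intro z i
    induction z using DirectSum.induction_on with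
    | zero => simp
    | of j x =>
      rw [DirectSum.toAddMonoid_of]
      by_cases hij : j = i
      · subst hij
        simp [Preadditive.rightComp]
      · simp only [Preadditive.rightComp, AddMonoidHom.mk'_apply, Category.assoc,
          inj_coproductProj_of_ne hc hij, comp_zero]
        rw [DirectSum.of_eq_of_ne _ _ _ (Ne.symm hij)]
    | add a b ha hb =>
      rw [map_add, Preadditive.add_comp, ha, hb, DirectSum.add_apply]
  constructor
  · intro z z' hz
    refine DFinsupp.ext fun i => ?_
    have := congrArg (fun f => f ≫ coproductProj hc i) hz
    simpa only [key] using this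
  · intro f
    obtain ⟨F, g, rfl⟩ := h J X c hc f
    refine ⟨∑ j ∈ F, DirectSum.of (fun j => K ⟶ X j) j (g j), ?_⟩
    rw [map_sum]
    refine Finset.sum_congr rfl fun j _ => ?_
    rw [DirectSum.toAddMonoid_of]
    rfl

lemma IsCompactObject.exists_sum {K : T} (hK : IsCompactObject.{w} K) {J : Type w} {X : J → T}
    {c : Cofan X} (hc : IsColimit c) (f : K ⟶ c.pt) :
    ∃ (F : Finset J) (g : ∀ j, K ⟶ X j), f = ∑ j ∈ F, g j ≫ c.inj j := by
  classical
  obtain ⟨z, rfl⟩ := (hK J X c hc).2 f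
  induction z using DirectSum.induction_on with
  | zero => exact ⟨∅, fun _ => 0, by simp⟩
  | of j x =>
    refine ⟨{j}, fun i => if h : j = i then x ≫ eqToHom (by rw [h]) else 0, ?_⟩
    rw [DirectSum.toAddMonoid_of]
    simp [Preadditive.rightComp]
  | add a b ha hb =>
    rw [map_add]
    exact exists_sum_add ha hb

lemma IsCompactObject.exists_eq_sum_proj {K : T} (hK : IsCompactObject.{w} K) {J : Type w}
    {X : J → T} {c : Cofan X} (hc : IsColimit c) (f : K ⟶ c.pt) :
    ∃ F : Finset J, f = ∑ j ∈ F, (f ≫ coproductProj hc j) ≫ c.inj j := by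
  obtain ⟨F, g, hf⟩ := hK.exists_sum hc f
  refine ⟨F, hf.trans (Finset.sum_congr rfl fun j hj => ?_)⟩
  rw [hf, sum_comp_coproductProj hc F g hj]

/-- Two morphisms from a compact object to a coproduct agree if all their components do. -/
lemma IsCompactObject.eq_zero_of_comp_proj {K : T} (hK : IsCompactObject.{w} K) {J : Type w}
    {X : J → T} {c : Cofan X} (hc : IsColimit c) (f : K ⟶ c.pt)
    (h : ∀ j, f ≫ coproductProj hc j = 0) : f = 0 := by
  obtain ⟨F, hf⟩ := hK.exists_eq_sum_proj hc f
  rw [hf]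
  exact Finset.sum_eq_zero fun j _ => by rw [h, zero_comp]

lemma IsCompactObject.of_retract {K L : T} (r : Retract K L) (hL : IsCompactObject.{w} L) :
    IsCompactObject.{w} K := by
  refine isCompactObject_of_exists_sum fun J X c hc f => ?_
  obtain ⟨F, g, hf⟩ := hL.exists_sum hc (r.r ≫ f)
  refine ⟨F, fun j => r.i ≫ g j, ?_⟩
  simp only [Category.assoc, ← Preadditive.comp_sum, ← hf, r.retract_assoc]

/-- A morphism from a compact object to the start of a sequence dies at a finite stage if
`1 - shift` is an isomorphism on the coproduct of the sequence. -/
lemma IsCompactObject.exists_sequence_comp_eq_zero {K : T} (hK : IsCompactObject.{w} K)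
    (X : ℕ → T) (t : ∀ n, X n ⟶ X (n + 1)) (c : Cofan (fun n : ULift.{w} ℕ => X n.down))
    (hc : IsColimit c) (s : c.pt ⟶ c.pt)
    (hs : ∀ n : ℕ, c.inj ⟨n⟩ ≫ s = t n ≫ c.inj ⟨n + 1⟩) [IsIso (𝟙 c.pt - s)]
    (k : ∀ n, K ⟶ X n) (hk : ∀ n, k (n + 1) = k n ≫ t n) : ∃ n, k n = 0 := by
  have hs0 : s ≫ coproductProj hc ⟨0⟩ = 0 := by
    refine Cofan.IsColimit.hom_ext hc _ _ fun ⟨n⟩ => ?_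
    rw [← Category.assoc, hs, Category.assoc,
      inj_coproductProj_of_ne hc (by simp [ULift.ext_iff]), comp_zero, comp_zero]
  have hs1 : ∀ n : ℕ, s ≫ coproductProj hc ⟨n + 1⟩ = coproductProj hc ⟨n⟩ ≫ t n := by
    intro n
    refine Cofan.IsColimit.hom_ext hc _ _ fun ⟨m⟩ => ?_
    rw [← Category.assoc, hs, Category.assoc]
    by_cases hmn : m = n
    · subst hmn
      rw [inj_coproductProj_self, inj_coproductProj_self_assoc]
      simp
    · rw [inj_coproductProj_of_ne hc (by simpa [ULift.ext_iff] using hmn),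
        inj_coproductProj_of_ne_assoc hc (by simpa [ULift.ext_iff] using hmn),
        comp_zero]
  -- Dividing `k 0` by `1 - s` forces the component of `g` at `n` to be `k n`; compactness allows
  -- only finitely many nonzero components.
  set g : K ⟶ c.pt := (k 0 ≫ c.inj ⟨0⟩) ≫ inv (𝟙 c.pt - s) with hgdef
  have hg : g - g ≫ s = k 0 ≫ c.inj ⟨0⟩ := by
    have : g ≫ (𝟙 c.pt - s) = k 0 ≫ c.inj ⟨0⟩ := by simp [hgdef, -Preadditive.comp_sub]
    rwa [Preadditive.comp_sub, Category.comp_id] at this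
  clear_value g
  have hgk : ∀ n : ℕ, g ≫ coproductProj hc ⟨n⟩ = k n := by
    intro n
    induction n with
    | zero =>
      have := congrArg (fun f => f ≫ coproductProj hc ⟨0⟩) hg
      simpa [Preadditive.sub_comp, hs0] using this
    | succ n ih =>
      have := congrArg (fun f => f ≫ coproductProj hc ⟨n + 1⟩) hg
      simp only [Preadditive.sub_comp, Category.assoc, hs1] at this
      rw [inj_coproductProj_of_ne hc (by simp [ULift.ext_iff]), comp_zero, sub_eq_zero] at this
      rw [this, hk, ← ih, Category.assoc]
  obtain ⟨F, hF⟩ := hK.exists_eq_sum_proj hc g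
  obtain ⟨⟨n⟩, hn⟩ := Infinite.exists_notMem_finset F
  refine ⟨n, ?_⟩
  rw [← hgk, hF]
  exact sum_comp_coproductProj_of_notMem hc F _ hn

variable [HasShift T ℤ] [∀ n : ℤ, (shiftFunctor T n).Additive]

lemma isCompactObject_shift {K : T} (hK : IsCompactObject.{w} K) (n : ℤ) :
    IsCompactObject.{w} (K⟦n⟧) := by
  refine isCompactObject_of_exists_sum fun J X c hc f => ?_
  have hK' : IsCompactObject.{w} (K⟦n⟧⟦-n⟧) :=
    hK.of_retract (Retract.ofIso ((shiftFunctorCompIsoId T n (-n) (by lia)).app K))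
  obtain ⟨F, g, hg⟩ := hK'.exists_sum (isColimitMapCofan (shiftFunctor T (-n)) hc) (f⟦-n⟧')
  choose g' hg' using fun j => (shiftFunctor T (-n)).map_surjective (g j)
  refine ⟨F, g', (shiftFunctor T (-n)).map_injective ?_⟩
  rw [hg, Functor.map_sum]
  refine Finset.sum_congr rfl fun j _ => ?_
  rw [← hg', Functor.map_comp]
  rfl

variable [HasZeroObject T] [Pretriangulated T]

/-- Restricted to `A.obj₁`, a morphism has finitely many components. Each kills the connecting map
and so extends to `A.obj₂`; the difference factors through `A.obj₃`, where compactness applies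
again. -/
lemma isCompactObject_ext₂ (A : Triangle T) (hA : A ∈ distTriang T)
    (h₁ : IsCompactObject.{w} A.obj₁) (h₃ : IsCompactObject.{w} A.obj₃) :
    IsCompactObject.{w} A.obj₂ := by
  refine isCompactObject_of_exists_sum fun J X c hc f => ?_
  obtain ⟨F, g, hg⟩ := h₁.exists_sum hc (A.mor₁ ≫ f)
  obtain ⟨u, h0, hu⟩ : ∃ u : A.obj₃⟦(-1 : ℤ)⟧ ⟶ A.obj₁, u ≫ A.mor₁ = 0 ∧
      ∀ {Y : T} (g : A.obj₁ ⟶ Y), u ≫ g = 0 → ∃ g', g = A.mor₁ ≫ g' :=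
    ⟨A.invRotate.mor₁, comp_distTriang_mor_zero₁₂ _ (inv_rot_of_distTriang _ hA),
      Triangle.yoneda_exact₂ _ (inv_rot_of_distTriang _ hA)⟩
  have h1 : (∑ j ∈ F, (u ≫ g j) ≫ c.inj j) = 0 := by
    simp only [Category.assoc, ← Preadditive.comp_sum, ← hg, reassoc_of% h0, zero_comp]
  have hg0 : ∀ j ∈ F, u ≫ g j = 0 := by
    intro j hj
    rw [← sum_comp_coproductProj hc F (fun j => u ≫ g j) hj, h1, zero_comp]
  have : ∀ j, ∃ g' : A.obj₂ ⟶ X j, j ∈ F → g j = A.mor₁ ≫ g' := by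
    intro j
    by_cases hj : j ∈ F
    · obtain ⟨g', hg'⟩ := hu (g j) (hg0 j hj)
      exact ⟨g', fun _ => hg'⟩
    · exact ⟨0, fun h => (hj h).elim⟩
  choose g' hg' using this
  have h2 : A.mor₁ ≫ (f - ∑ j ∈ F, g' j ≫ c.inj j) = 0 := by
    rw [Preadditive.comp_sub, hg, Preadditive.comp_sum, sub_eq_zero]
    exact Finset.sum_congr rfl fun j hj => by rw [hg' j hj, Category.assoc]
  obtain ⟨e, he⟩ := Triangle.yoneda_exact₂ _ hA _ h2
  obtain ⟨F', g'', hF'⟩ := h₃.exists_sum hc e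
  rw [← sub_add_cancel f (∑ j ∈ F, g' j ≫ c.inj j)]
  refine exists_sum_add ⟨F', fun j => A.mor₂ ≫ g'' j, ?_⟩ ⟨F, g', rfl⟩
  rw [he, hF', Preadditive.comp_sum]
  simp

instance : ObjectProperty.IsTriangulated (fun K : T => IsCompactObject.{w} K) where
  exists_zero := ⟨_, isZero_zero T, isCompactObject_of_exists_sum fun _ _ _ _ _ =>
    ⟨∅, fun _ => 0, (isZero_zero T).eq_of_src _ _⟩⟩
  isStableUnderShiftBy n := ⟨fun _ hX => isCompactObject_shift hX n⟩
  ext₂' A hA h₁ h₃ := ObjectProperty.le_isoClosure _ _ (isCompactObject_ext₂ A hA h₁ h₃)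

end CompactObjects

/-! ### Coproducts of complexes: homology, quasi-isomorphisms, homotopies -/

section CoproductsOfComplexes

variable {R : Type u} [CommRing R]

lemma exists_sum_inj_apply {J : Type*} {X : J → ModuleCat.{u} R} {c : Cofan X} (hc : IsColimit c)
    (x : c.pt) : ∃ (F : Finset J) (g : ∀ j, X j), x = ∑ j ∈ F, c.inj j (g j) := by
  classical
  set S : Submodule R c.pt := ⨆ j, LinearMap.range (c.inj j).hom with hS
  have hS' : S = ⊤ := by
    have h : ModuleCat.ofHom S.mkQ = 0 := Cofan.IsColimit.hom_ext hc _ _ fun j => by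
      ext y
      simpa [hS] using (Submodule.mem_iSup_of_mem j ⟨y, rfl⟩ :
        c.inj j y ∈ ⨆ j, LinearMap.range (c.inj j).hom)
    rw [← Submodule.ker_mkQ S]
    ext y
    simpa using congrArg (fun f => f y) h
  have hx : x ∈ S := by rw [hS']; trivial
  induction hx using Submodule.iSup_induction' with
  | mem j y hy =>
    obtain ⟨y, rfl⟩ := hy
    exact ⟨{j}, Function.update (fun _ => 0) j y, by simp⟩
  | zero => exact ⟨∅, fun _ => 0, by simp⟩
  | add y z _ _ hy hz =>
    obtain ⟨F, g, rfl⟩ := hy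
    obtain ⟨F', g', rfl⟩ := hz
    refine ⟨F ∪ F', fun j => (if j ∈ F then g j else 0) + (if j ∈ F' then g' j else 0), ?_⟩
    simp only [map_add, Finset.sum_add_distrib]
    congr 1
    · rw [← Finset.sum_subset (Finset.subset_union_left (s₂ := F'))]
      · exact Finset.sum_congr rfl fun j hj => by simp [hj]
      · intro j _ hj; simp [hj]
    · rw [← Finset.sum_subset (Finset.subset_union_right (s₁ := F))]
      · exact Finset.sum_congr rfl fun j hj => by simp [hj]
      · intro j _ hj; simp [hj]

variable {J : Type u} {A : J → CochainComplex (ModuleCat.{u} R) ℤ} {c : Cofan A}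
  (hc : IsColimit c)

include hc in
lemma exists_sum_inj_f_apply (n : ℤ) (x : c.pt.X n) :
    ∃ F : Finset J, x = ∑ j ∈ F, (c.inj j).f n ((coproductProj hc j).f n x) := by
  obtain ⟨F, g, hx⟩ : ∃ (F : Finset J) (g : ∀ j, (A j).X n),
      x = ∑ j ∈ F, (c.inj j).f n (g j) := exists_sum_inj_apply
    (isColimitMapCofan (HomologicalComplex.eval (ModuleCat.{u} R) (ComplexShape.up ℤ) n) hc) x
  refine ⟨F, hx.trans (Finset.sum_congr rfl fun j hj => ?_)⟩
  have hg : (coproductProj hc j).f n x = g j := by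
    rw [hx, map_sum, Finset.sum_eq_single_of_mem j hj]
    · change ((c.inj j).f n ≫ (coproductProj hc j).f n) (g j) = g j
      rw [← HomologicalComplex.comp_f, inj_coproductProj_self]
      rfl
    · intro i _ hi
      change ((c.inj i).f n ≫ (coproductProj hc j).f n) (g i) = 0
      rw [← HomologicalComplex.comp_f, inj_coproductProj_of_ne hc hi]
      rfl
  rw [hg]

lemma sum_f_apply {J : Type*} {A B : CochainComplex (ModuleCat.{u} R) ℤ} (F : Finset J)
    (g : J → (A ⟶ B)) (n : ℤ) (x : A.X n) :
    (∑ j ∈ F, g j).f n x = ∑ j ∈ F, (g j).f n x := by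
  classical
  induction F using Finset.induction_on with
  | empty => simp
  | insert j F hj ih => simp [Finset.sum_insert hj, ← ih]

lemma homologyπ_surjective (K : CochainComplex (ModuleCat.{u} R) ℤ) (n : ℤ) :
    Function.Surjective (K.homologyπ n) :=
  (ModuleCat.epi_iff_surjective _).1 inferInstance

lemma iCycles_injective (K : CochainComplex (ModuleCat.{u} R) ℤ) (n : ℤ) :
    Function.Injective (K.iCycles n) :=
  (ModuleCat.mono_iff_injective _).1 inferInstance

/-- A representing cycle has finitely many components, and these are cycles. This plays the role of
the commutation of homology with coproducts. -/
lemma exists_sum_homologyMap_apply (n : ℤ) (h : c.pt.homology n) :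
    ∃ F : Finset J, h = ∑ j ∈ F, HomologicalComplex.homologyMap (c.inj j) n
      (HomologicalComplex.homologyMap (coproductProj hc j) n h) := by
  obtain ⟨z, rfl⟩ := homologyπ_surjective _ _ h
  obtain ⟨F, hF⟩ := exists_sum_inj_f_apply hc n (c.pt.iCycles n z)
  refine ⟨F, ?_⟩
  have hz : z = ∑ j ∈ F, HomologicalComplex.cyclesMap (c.inj j) n
      (HomologicalComplex.cyclesMap (coproductProj hc j) n z) := by
    apply iCycles_injective
    rw [map_sum]
    refine hF.trans (Finset.sum_congr rfl fun j _ => ?_)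
    simp only [← ConcreteCategory.comp_apply, HomologicalComplex.cyclesMap_i,
      HomologicalComplex.cyclesMap_i_assoc, Category.assoc]
  conv_lhs => rw [hz, map_sum]
  refine Finset.sum_congr rfl fun j _ => ?_
  simp only [← ConcreteCategory.comp_apply, HomologicalComplex.homologyπ_naturality, Category.assoc]

include hc in
lemma homologyMap_eq_zero_of_coproduct {B : CochainComplex (ModuleCat.{u} R) ℤ} (f : c.pt ⟶ B)
    (n : ℤ) (hf : ∀ j, HomologicalComplex.homologyMap (c.inj j ≫ f) n = 0) :
    HomologicalComplex.homologyMap f n = 0 := by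
  ext h
  obtain ⟨F, hF⟩ := exists_sum_homologyMap_apply hc n h
  rw [hF, map_sum]
  refine Finset.sum_eq_zero fun j _ => ?_
  rw [← ConcreteCategory.comp_apply, ← HomologicalComplex.homologyMap_comp, hf]
  rfl

include hc in
lemma quasiIso_of_coproduct {A' : J → CochainComplex (ModuleCat.{u} R) ℤ} {c' : Cofan A'}
    (hc' : IsColimit c') (φ : ∀ j, A j ⟶ A' j) [∀ j, QuasiIso (φ j)]
    (f : c.pt ⟶ c'.pt) (hf : ∀ j, c.inj j ≫ f = φ j ≫ c'.inj j) : QuasiIso f := by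
  have hπ : ∀ j, f ≫ coproductProj hc' j = coproductProj hc j ≫ φ j := by
    intro j
    refine Cofan.IsColimit.hom_ext hc _ _ fun i => ?_
    rw [← Category.assoc, hf, Category.assoc]
    by_cases hij : i = j
    · subst hij
      simp
    · rw [inj_coproductProj_of_ne hc' hij, inj_coproductProj_of_ne_assoc hc hij]
      simp
  rw [quasiIso_iff]
  intro n
  rw [quasiIsoAt_iff_isIso_homologyMap, ConcreteCategory.isIso_iff_bijective]
  have hφ : ∀ j, Function.Bijective (HomologicalComplex.homologyMap (φ j) n) := fun j =>
    ConcreteCategory.bijective_of_isIso _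
  constructor
  · rw [injective_iff_map_eq_zero]
    intro h hh
    obtain ⟨F, hF⟩ := exists_sum_homologyMap_apply hc n h
    rw [hF]
    refine Finset.sum_eq_zero fun j _ => ?_
    have : HomologicalComplex.homologyMap (coproductProj hc j) n h = 0 := by
      apply (hφ j).1
      rw [map_zero, ← ConcreteCategory.comp_apply, ← HomologicalComplex.homologyMap_comp, ← hπ,
        HomologicalComplex.homologyMap_comp, ConcreteCategory.comp_apply, hh, map_zero]
    rw [this, map_zero]
  · intro h
    obtain ⟨F, hF⟩ := exists_sum_homologyMap_apply hc' n h
    choose g hg using fun j => (hφ j).2 (HomologicalComplex.homologyMap (coproductProj hc' j) n h)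
    refine ⟨∑ j ∈ F, HomologicalComplex.homologyMap (c.inj j) n (g j), ?_⟩
    rw [map_sum]
    conv_rhs => rw [hF]
    refine Finset.sum_congr rfl fun j _ => ?_
    rw [← hg, ← ConcreteCategory.comp_apply, ← ConcreteCategory.comp_apply,
      ← HomologicalComplex.homologyMap_comp, ← HomologicalComplex.homologyMap_comp, hf]

/-- If all transition maps of a sequence of complexes vanish on homology, then `1 - shift` is a
quasi-isomorphism on the coproduct. -/
lemma quasiIso_id_sub_shift (X : ℕ → CochainComplex (ModuleCat.{u} R) ℤ)
    (t : ∀ n, X n ⟶ X (n + 1)) (ht : ∀ n i, HomologicalComplex.homologyMap (t n) i = 0)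
    {c : Cofan (fun n : ULift.{u} ℕ => X n.down)} (hc : IsColimit c) (s : c.pt ⟶ c.pt)
    (hs : ∀ n : ℕ, c.inj ⟨n⟩ ≫ s = t n ≫ c.inj ⟨n + 1⟩) : QuasiIso (𝟙 c.pt - s) := by
  rw [quasiIso_iff]
  intro n
  rw [quasiIsoAt_iff_isIso_homologyMap, HomologicalComplex.homologyMap_sub,
    homologyMap_eq_zero_of_coproduct hc s n fun ⟨j⟩ => by
      rw [hs, HomologicalComplex.homologyMap_comp, ht, zero_comp], sub_zero,
    HomologicalComplex.homologyMap_id]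
  infer_instance

include hc in
/-- Null-homotopies on the summands assemble to a null-homotopy on the coproduct. -/
lemma nonempty_homotopy_zero_of_coproduct {L : CochainComplex (ModuleCat.{u} R) ℤ} (f : c.pt ⟶ L)
    (hf : ∀ j, Nonempty (Homotopy (c.inj j ≫ f) 0)) : Nonempty (Homotopy f 0) := by
  have h := fun j => (hf j).some
  let hc' := fun n =>
    isColimitMapCofan (HomologicalComplex.eval (ModuleCat.{u} R) (ComplexShape.up ℤ) n) hc
  let H : ∀ i j, c.pt.X i ⟶ L.X j := fun i j =>
    Cofan.IsColimit.desc (hc' i) (fun a => (h a).hom i j)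
  have hH : ∀ a i j, (c.inj a).f i ≫ H i j = (h a).hom i j := fun a i j =>
    Cofan.IsColimit.fac (hc' i) (fun a => (h a).hom i j) a
  refine ⟨{ hom := H, zero := fun i j hij => ?_, comm := fun i => ?_ }⟩
  · refine Cofan.IsColimit.hom_ext (hc' i) _ _ fun a => ?_
    exact (hH a i j).trans (((h a).zero i j hij).trans comp_zero.symm)
  · refine Cofan.IsColimit.hom_ext (hc' i) _ _ fun a => ?_
    refine ((h a).comm i).trans ?_
    change _ = (c.inj a).f i ≫ _
    rw [Preadditive.comp_add, Preadditive.comp_add]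
    congr 2
    · rw [dNext_eq _ (show (ComplexShape.up ℤ).Rel i (i + 1) from rfl),
        dNext_eq _ (show (ComplexShape.up ℤ).Rel i (i + 1) from rfl), ← hH,
        HomologicalComplex.Hom.comm_assoc]
    · rw [prevD_eq _ (show (ComplexShape.up ℤ).Rel (i - 1) i by simp),
        prevD_eq _ (show (ComplexShape.up ℤ).Rel (i - 1) i by simp), ← hH, Category.assoc]

include hc in
lemma isKProjective_of_coproduct [∀ j, (A j).IsKProjective] : c.pt.IsKProjective where
  nonempty_homotopy_zero f hL := nonempty_homotopy_zero_of_coproduct hc f fun _ =>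
    CochainComplex.IsKProjective.nonempty_homotopy_zero _ hL

end CoproductsOfComplexes

/-! ### Cells, covers by cells, and the tower of iterated cones -/

section GhostTower

variable {R : Type u} [CommRing R]

section Cells

variable (R) in
/-- The complex `R` concentrated in degree `n`. -/
abbrev cell (n : ℤ) : CochainComplex (ModuleCat.{u} R) ℤ :=
  (HomologicalComplex.single (ModuleCat.{u} R) (ComplexShape.up ℤ) n).obj (ModuleCat.of R R)

instance (n i : ℤ) : Projective ((cell R n).X i) := by
  by_cases h : i = n
  · subst h
    exact Projective.of_iso (HomologicalComplex.singleObjXSelf (ComplexShape.up ℤ) i _).symm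
      inferInstance
  · exact Projective.of_iso ((HomologicalComplex.isZero_single_obj_X (ComplexShape.up ℤ) n _ i h).iso
      (isZero_zero _)).symm inferInstance

instance (n : ℤ) : (cell R n).IsKProjective :=
  CochainComplex.isKProjective_of_projective _ n

/-- The generator of `cell R n`. -/
def cellGen (n : ℤ) : (cell R n).X n :=
  (HomologicalComplex.singleObjXSelf (ComplexShape.up ℤ) n (ModuleCat.of R R)).inv (1 : R)

lemma cell_hom_ext {n : ℤ} {K : CochainComplex (ModuleCat.{u} R) ℤ} {f g : cell R n ⟶ K}
    (h : f.f n (cellGen n) = g.f n (cellGen n)) : f = g := by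
  apply HomologicalComplex.from_single_hom_ext
  rw [← cancel_epi (HomologicalComplex.singleObjXSelf (ComplexShape.up ℤ) n _).inv]
  apply ModuleCat.hom_ext
  apply LinearMap.ext_ring
  exact h

/-- The morphism `cell R n ⟶ K` corresponding to an element killed by the differential. -/
def cellHom {n : ℤ} {K : CochainComplex (ModuleCat.{u} R) ℤ} (x : K.X n)
    (hx : K.d n (n + 1) x = 0) : cell R n ⟶ K :=
  HomologicalComplex.mkHomFromSingle (ModuleCat.ofHom (LinearMap.toSpanSingleton R _ x))
    (by
      rintro k rfl
      apply ModuleCat.hom_ext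
      apply LinearMap.ext_ring
      simpa using hx)

lemma cellHom_f_cellGen {n : ℤ} {K : CochainComplex (ModuleCat.{u} R) ℤ} (x : K.X n)
    (hx : K.d n (n + 1) x = 0) : (cellHom x hx).f n (cellGen n) = x := by
  simp only [cellHom, cellGen, HomologicalComplex.mkHomFromSingle_f,
    ← ConcreteCategory.comp_apply, Iso.inv_hom_id_assoc]
  exact one_smul R x

lemma exists_cellGen_cycle (n : ℤ) : ∃ u : (cell R n).cycles n,
    (cell R n).iCycles n u = cellGen n := by
  let φ := (HomologicalComplex.singleObjXSelf (ComplexShape.up ℤ) n (ModuleCat.of R R)).inv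
  refine ⟨(cell R n).liftCycles φ (n + 1) (by simp) (by simp) (1 : R), ?_⟩
  rw [← ConcreteCategory.comp_apply, HomologicalComplex.liftCycles_i]
  rfl

end Cells

section Tower

variable (K : CochainComplex (ModuleCat.{u} R) ℤ)

lemma d_iCycles_apply (n : ℤ) (z : K.cycles n) : K.d n (n + 1) (K.iCycles n z) = 0 := by
  rw [← ConcreteCategory.comp_apply, HomologicalComplex.iCycles_d]
  rfl

/-- The coproduct of cells, one for each cycle of `K`. -/
def cellCofan : Cofan (fun p : Σ n : ℤ, K.cycles n => cell R p.1) := Cofan.mk _ (Sigma.ι _)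

/-- The cofan `cellCofan` is a coproduct. -/
def isColimitCellCofan : IsColimit (cellCofan K) := coproductIsCoproduct _

/-- A coproduct of cells, one for each cycle of `K`. -/
abbrev cellCover : CochainComplex (ModuleCat.{u} R) ℤ := (cellCofan K).pt

/-- The tautological morphism `cellCover K ⟶ K`, which is surjective on homology. -/
def cellCoverMap : cellCover K ⟶ K :=
  Cofan.IsColimit.desc (isColimitCellCofan K)
    fun p => cellHom (K.iCycles p.1 p.2) (d_iCycles_apply K p.1 p.2)

instance : (cellCover K).IsKProjective :=
  isKProjective_of_coproduct (isColimitCellCofan K)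

instance (n : ℤ) : Epi (HomologicalComplex.homologyMap (cellCoverMap K) n) := by
  rw [ModuleCat.epi_iff_surjective]
  intro h
  obtain ⟨z, rfl⟩ := homologyπ_surjective _ _ h
  obtain ⟨u, hu⟩ := exists_cellGen_cycle (R := R) n
  let σ := cellHom (K.iCycles n z) (d_iCycles_apply K n z)
  have hz : HomologicalComplex.cyclesMap σ n u = z := by
    apply iCycles_injective
    rw [← ConcreteCategory.comp_apply, HomologicalComplex.cyclesMap_i,
      ConcreteCategory.comp_apply, hu]
    exact cellHom_f_cellGen _ _
  have hσ : (cellCofan K).inj ⟨n, z⟩ ≫ cellCoverMap K = σ :=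
    Cofan.IsColimit.fac _ _ _
  refine ⟨HomologicalComplex.homologyMap ((cellCofan K).inj ⟨n, z⟩) n
      ((cell R n).homologyπ n u), ?_⟩
  rw [← ConcreteCategory.comp_apply, ← HomologicalComplex.homologyMap_comp, hσ,
    ← ConcreteCategory.comp_apply, HomologicalComplex.homologyπ_naturality,
    ConcreteCategory.comp_apply, hz]

/-- The iterated cones of the covers by cells. -/
def ghostTower : ℕ → CochainComplex (ModuleCat.{u} R) ℤ
  | 0 => K
  | n + 1 => CochainComplex.mappingCone (cellCoverMap (ghostTower n))

/-- The transition maps of the tower of iterated cones. -/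
def ghostTowerMap (n : ℕ) : ghostTower K n ⟶ ghostTower K (n + 1) :=
  CochainComplex.mappingCone.inr (cellCoverMap (ghostTower K n))

/-- The cover is surjective on homology, and followed by the inclusion into its cone it is
null-homotopic. -/
lemma homologyMap_ghostTowerMap (n : ℕ) (i : ℤ) :
    HomologicalComplex.homologyMap (ghostTowerMap K n) i = 0 := by
  rw [← cancel_epi (HomologicalComplex.homologyMap (cellCoverMap (ghostTower K n)) i), comp_zero,
    ← HomologicalComplex.homologyMap_comp]
  exact ((HomologicalComplex.homotopyCofiber.inrCompHomotopy (cellCoverMap (ghostTower K n))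
    (fun j => ⟨j - 1, by simp⟩)).homologyMap_eq i).trans
      (HomologicalComplex.homologyMap_zero _ _ _)

lemma isKProjective_mappingCone {A B : CochainComplex (ModuleCat.{u} R) ℤ} (f : A ⟶ B)
    [A.IsKProjective] [B.IsKProjective] : (CochainComplex.mappingCone f).IsKProjective := by
  rw [CochainComplex.isKProjective_iff_leftOrthogonal]
  exact ObjectProperty.ext_of_isTriangulatedClosed₃ _ _
    (HomotopyCategory.mappingCone_triangleh_distinguished f)
    (CochainComplex.IsKProjective.leftOrthogonal A)
    (CochainComplex.IsKProjective.leftOrthogonal B)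

instance isKProjective_ghostTower [K.IsKProjective] (n : ℕ) :
    (ghostTower K n).IsKProjective := by
  induction n with
  | zero => assumption
  | succ n _ => exact isKProjective_mappingCone _

/-- The coproduct of the tower. -/
def ghostCofan : Cofan (fun n : ULift.{u} ℕ => ghostTower K n.down) := Cofan.mk _ (Sigma.ι _)

/-- The cofan `ghostCofan` is a coproduct. -/
def isColimitGhostCofan : IsColimit (ghostCofan K) := coproductIsCoproduct _

/-- The shift map on the coproduct of the tower. -/
def ghostShift : (ghostCofan K).pt ⟶ (ghostCofan K).pt :=
  Cofan.IsColimit.desc (isColimitGhostCofan K)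
    fun n => ghostTowerMap K n.down ≫ (ghostCofan K).inj ⟨n.down + 1⟩

lemma inj_ghostShift (n : ℕ) : (ghostCofan K).inj ⟨n⟩ ≫ ghostShift K =
    ghostTowerMap K n ≫ (ghostCofan K).inj ⟨n + 1⟩ :=
  Cofan.IsColimit.fac _ _ _

instance : QuasiIso (𝟙 _ - ghostShift K) :=
  quasiIso_id_sub_shift (ghostTower K) (ghostTowerMap K) (homologyMap_ghostTowerMap K)
    (isColimitGhostCofan K) _ (inj_ghostShift K)

end Tower

end GhostTower

/-! ### Coproducts in the derived category; compactness of cells -/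

section CoproductsDerived

variable {R : Type u} [CommRing R] [HasDerivedCategory.{w} (ModuleCat.{u} R)]

open DerivedCategory

lemma exists_homotopy_zero_of_Q_map_eq_zero {A B : CochainComplex (ModuleCat.{u} R) ℤ}
    (f : A ⟶ B) (hf : Q.map f = 0) :
    ∃ (A' : CochainComplex (ModuleCat.{u} R) ℤ) (s : A' ⟶ A),
      QuasiIso s ∧ Nonempty (Homotopy (s ≫ f) 0) := by
  have h : Qh.map ((HomotopyCategory.quotient _ _).map f) = Qh.map 0 := by
    rw [← cancel_mono ((quotientCompQhIso (ModuleCat.{u} R)).hom.app B),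
      quotientCompQhIso_hom_naturality, hf]
    simp
  rw [MorphismProperty.map_eq_iff_precomp Qh (HomotopyCategory.quasiIso (ModuleCat.{u} R) _)] at h
  obtain ⟨A', s, hs, h⟩ := h
  obtain ⟨A', rfl⟩ := HomotopyCategory.quotient_obj_surjective A'
  obtain ⟨s, rfl⟩ := (HomotopyCategory.quotient _ _).map_surjective s
  rw [← isIso_Qh_map_iff] at hs
  refine ⟨A', s, ?_, ?_⟩
  · rw [← isIso_Q_map_iff_quasiIso]
    exact hs
  · rw [comp_zero, ← Functor.map_comp, HomotopyCategory.quotient_map_eq_zero_iff] at h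
    exact h

section

variable {J : Type u} {A : J → CochainComplex (ModuleCat.{u} R) ℤ} {c : Cofan A}
  (hc : IsColimit c)

include hc in
-- A left fraction replaces `f` by a chain map. On each summand it is null-homotopic after a
-- quasi-isomorphism; the coproduct of these is again a quasi-isomorphism, and the homotopies
-- assemble over it.
lemma eq_zero_of_Q_map_inj_comp {X : DerivedCategory (ModuleCat.{u} R)} (f : Q.obj c.pt ⟶ X)
    (hf : ∀ j, Q.map (c.inj j) ≫ f = 0) : f = 0 := by
  obtain ⟨L, ⟨e⟩⟩ : ∃ L, Nonempty (Q.obj L ≅ X) := ⟨_, ⟨Q.objObjPreimageIso X⟩⟩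
  obtain ⟨L', g, s, hs, hg⟩ := left_fac (f ≫ e.inv)
  have hg' : Q.map g = f ≫ e.inv ≫ Q.map s := by
    rw [← Category.assoc, hg, Category.assoc, IsIso.inv_hom_id, Category.comp_id]
  have h0 : ∀ j, Q.map (c.inj j ≫ g) = 0 := fun j => by
    rw [Functor.map_comp, hg', reassoc_of% (hf j), zero_comp]
  choose B σ hσ H using fun j => exists_homotopy_zero_of_Q_map_eq_zero _ (h0 j)
  let τ : (∐ B) ⟶ c.pt := Sigma.desc (fun j => σ j ≫ c.inj j)
  have hτ : QuasiIso τ := quasiIso_of_coproduct (coproductIsCoproduct B) hc σ τ (fun j => by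
    exact Sigma.ι_desc _ _)
  have h1 : Nonempty (Homotopy (τ ≫ g) 0) :=
    nonempty_homotopy_zero_of_coproduct (coproductIsCoproduct B) _ fun j => by
      obtain ⟨h⟩ := H j
      have : (Cofan.mk (∐ B) (Sigma.ι B)).inj j ≫ τ ≫ g = σ j ≫ c.inj j ≫ g := by
        exact (Sigma.ι_desc_assoc _ _ _).trans (Category.assoc _ _ _)
      exact ⟨(Homotopy.ofEq this).trans h⟩
  have h2 : Q.map τ ≫ Q.map g = 0 := by
    rw [← Functor.map_comp, Q_map_eq_of_homotopy _ h1.some, Functor.map_zero]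
  have h3 : Q.map g = 0 := by
    rwa [← cancel_epi (Q.map τ), comp_zero]
  rw [← cancel_mono e.inv, hg, h3, zero_comp, zero_comp]

include hc in
lemma exists_Q_map_inj_comp_eq {X : DerivedCategory (ModuleCat.{u} R)}
    (f : ∀ j, Q.obj (A j) ⟶ X) :
    ∃ g : Q.obj c.pt ⟶ X, ∀ j, Q.map (c.inj j) ≫ g = f j := by
  obtain ⟨L, ⟨e⟩⟩ : ∃ L, Nonempty (Q.obj L ≅ X) := ⟨_, ⟨Q.objObjPreimageIso X⟩⟩
  choose B σ hσ γ hγ using fun j => right_fac (f j ≫ e.inv)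
  have hσ' : ∀ j, QuasiIso (σ j) := fun j => (isIso_Q_map_iff_quasiIso _ _).1 (hσ j)
  let τ : (∐ B) ⟶ c.pt := Sigma.desc (fun j => σ j ≫ c.inj j)
  have hτ : QuasiIso τ := quasiIso_of_coproduct (coproductIsCoproduct B) hc σ τ (fun j => by
    exact Sigma.ι_desc _ _)
  refine ⟨inv (Q.map τ) ≫ Q.map (Sigma.desc γ) ≫ e.hom, fun j => ?_⟩
  have h1 : Q.map (c.inj j) = inv (Q.map (σ j)) ≫ Q.map (Sigma.ι B j) ≫ Q.map τ := by
    rw [← Functor.map_comp, Sigma.ι_desc, Functor.map_comp, IsIso.inv_hom_id_assoc]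
  rw [h1]
  simp only [Category.assoc, IsIso.hom_inv_id_assoc]
  rw [← Functor.map_comp_assoc, Sigma.ι_desc, ← Category.assoc, ← hγ]
  simp

/-- The localization functor from complexes to the derived category preserves coproducts. -/
def isColimitQ : IsColimit (Cofan.mk (Q.obj c.pt) (fun j => Q.map (c.inj j))) :=
  Cofan.IsColimit.mk _
    (fun s => (exists_Q_map_inj_comp_eq hc s.inj).choose)
    (fun s => (exists_Q_map_inj_comp_eq hc s.inj).choose_spec)
    (fun s m hm => by
      rw [← sub_eq_zero]
      refine eq_zero_of_Q_map_inj_comp hc _ fun j => ?_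
      rw [Preadditive.comp_sub, (exists_Q_map_inj_comp_eq hc s.inj).choose_spec, sub_eq_zero]
      exact hm j)

end

/-- Every coproduct in the derived category comes from a coproduct of complexes. -/
lemma exists_coproduct_of_complexes {J : Type u} {X : J → DerivedCategory (ModuleCat.{u} R)}
    {c : Cofan X} (hc : IsColimit c) :
    ∃ (A : J → CochainComplex (ModuleCat.{u} R) ℤ) (e : ∀ j, Q.obj (A j) ≅ X j)
      (E : Q.obj (∐ A) ≅ c.pt), ∀ j, Q.map (Sigma.ι A j) ≫ E.hom = (e j).hom ≫ c.inj j := by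
  let A := fun j => Q.objPreimage (X j)
  let e : ∀ j, Q.obj (A j) ≅ X j := fun j => Q.objObjPreimageIso (X j)
  have hA := isColimitQ (coproductIsCoproduct A)
  let E : Q.obj (∐ A) ≅ c.pt :=
    { hom := Cofan.IsColimit.desc hA (fun j => (e j).hom ≫ c.inj j)
      inv := Cofan.IsColimit.desc hc (fun j => (e j).inv ≫ Q.map (Sigma.ι A j))
      hom_inv_id := Cofan.IsColimit.hom_ext hA _ _ fun j => by
        rw [Cofan.IsColimit.fac_assoc, Category.assoc, Cofan.IsColimit.fac, Iso.hom_inv_id_assoc]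
        exact (Category.comp_id _).symm
      inv_hom_id := Cofan.IsColimit.hom_ext hc _ _ fun j => by
        have := Cofan.IsColimit.fac hA (fun j => (e j).hom ≫ c.inj j) j
        rw [Cofan.IsColimit.fac_assoc, Category.assoc, Category.comp_id, Iso.inv_comp_eq]
        exact this }
  exact ⟨A, e, E, fun j => Cofan.IsColimit.fac hA (fun j => (e j).hom ≫ c.inj j) j⟩

lemma Q_map_surjective_of_isKProjective (P B : CochainComplex (ModuleCat.{u} R) ℤ)
    [P.IsKProjective] : Function.Surjective (Q.map : (P ⟶ B) → (Q.obj P ⟶ Q.obj B)) := by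
  intro f
  obtain ⟨g, hg⟩ := (CochainComplex.IsKProjective.Qh_map_bijective P _).surjective
    ((quotientCompQhIso _).hom.app P ≫ f ≫ (quotientCompQhIso _).inv.app B)
  obtain ⟨g, rfl⟩ := (HomotopyCategory.quotient _ _).map_surjective g
  refine ⟨g, ?_⟩
  rw [← cancel_epi ((quotientCompQhIso (ModuleCat.{u} R)).hom.app P),
    ← quotientCompQhIso_hom_naturality, hg]
  simp

/-- By K-projectivity a morphism from a cell is a chain map, determined by the image of the
generator, which has finitely many components. -/
lemma isCompactObject_cell (n : ℤ) : IsCompactObject.{u} (Q.obj (cell R n)) := by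
  refine isCompactObject_of_exists_sum fun J X c hc f => ?_
  obtain ⟨A, e, E, hE⟩ := exists_coproduct_of_complexes hc
  obtain ⟨φ, hφ⟩ := Q_map_surjective_of_isKProjective _ _ (f ≫ E.inv)
  let hA := coproductIsCoproduct A
  obtain ⟨F, hF⟩ := exists_sum_inj_f_apply hA n (φ.f n (cellGen n))
  have h : φ = ∑ j ∈ F, (φ ≫ coproductProj hA j) ≫ Sigma.ι A j := by
    apply cell_hom_ext
    refine hF.trans ?_
    exact (sum_f_apply F (fun j => (φ ≫ coproductProj hA j) ≫ Sigma.ι A j) n (cellGen n)).symm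
  refine ⟨F, fun j => Q.map (φ ≫ coproductProj hA j) ≫ (e j).hom, ?_⟩
  rw [← cancel_mono E.inv, ← hφ]
  conv_lhs => rw [h]
  rw [Functor.map_sum, Preadditive.sum_comp]
  refine Finset.sum_congr rfl fun j _ => ?_
  simp only [Category.assoc]
  rw [← reassoc_of% (hE j), Iso.hom_inv_id, Category.comp_id, ← Functor.map_comp, Category.assoc]

end CoproductsDerived

/-! ### The thick subcategory of objects whose morphisms from `K` are annihilated by `J` -/

lemma le_pow_sup_of_le_sq_sup {R : Type*} [CommRing R] {I J : Ideal R} (h : J ≤ J ^ 2 ⊔ I)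
    (m : ℕ) : J ≤ J ^ (m + 1) ⊔ I := by
  induction m with
  | zero => simp
  | succ m ih =>
    calc J ≤ J ^ 2 ⊔ I := h
      _ = J * J ⊔ I := by rw [sq]
      _ ≤ J * (J ^ (m + 1) ⊔ I) ⊔ I := sup_le_sup_right (Ideal.mul_mono_right ih) _
      _ ≤ J ^ (m + 1 + 1) ⊔ I := by
        rw [Ideal.mul_sup, ← pow_succ', sup_assoc]
        exact sup_le_sup_left (sup_le Ideal.mul_le_right le_rfl) _

section HomAnnihilated

variable {T : Type u} [Category.{v} T] [Preadditive T]

section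

variable {R : Type*} [CommRing R] [Linear R T]

variable (R) in
/-- The annihilator of a morphism in a linear category. -/
def homAnnihilator {X Y : T} (f : X ⟶ Y) : Ideal R where
  carrier := {r | r • f = 0}
  zero_mem' := zero_smul _ _
  add_mem' {a b} ha hb := by
    change (a + b) • f = 0
    rw [add_smul, show a • f = 0 from ha, show b • f = 0 from hb, add_zero]
  smul_mem' a b hb := by
    change (a * b) • f = 0
    rw [mul_smul, show b • f = 0 from hb, smul_zero]

lemma mem_homAnnihilator {X Y : T} {f : X ⟶ Y} {r : R} :
    r ∈ homAnnihilator R f ↔ r • f = 0 := Iff.rfl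

lemma homAnnihilator_le_comp {X Y Z : T} (f : X ⟶ Y) (g : Y ⟶ Z) :
    homAnnihilator R f ≤ homAnnihilator R (f ≫ g) := fun r hr => by
  rw [mem_homAnnihilator] at hr ⊢
  rw [← Linear.smul_comp, hr, zero_comp]

lemma homAnnihilator_le_comp' {X Y Z : T} (f : X ⟶ Y) (g : Y ⟶ Z) :
    homAnnihilator R g ≤ homAnnihilator R (f ≫ g) := fun r hr => by
  rw [mem_homAnnihilator] at hr ⊢
  rw [← Linear.comp_smul, hr, comp_zero]

lemma le_homAnnihilator_of_id {X Y : T} {I : Ideal R} (h : I ≤ homAnnihilator R (𝟙 X))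
    (f : X ⟶ Y) : I ≤ homAnnihilator R f := by
  simpa using h.trans (homAnnihilator_le_comp (𝟙 X) f)

lemma homAnnihilator_le_map {T' : Type*} [Category T'] [Preadditive T'] [Linear R T']
    (F : T ⥤ T') [F.Additive] [F.Linear R] {X Y : T} (f : X ⟶ Y) :
    homAnnihilator R f ≤ homAnnihilator R (F.map f) := fun r hr => by
  rw [mem_homAnnihilator] at hr ⊢
  rw [← F.map_smul, hr, F.map_zero]

end

variable [HasShift T ℤ] [∀ n : ℤ, (shiftFunctor T n).Additive]
  {R : Type*} [CommRing R] [Linear R T]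

/-- The objects `X` such that `J` annihilates all morphisms from shifts of `K` to `X`. -/
def homAnnihilated (K : T) (J : Ideal R) : ObjectProperty T :=
  fun X => ∀ (n : ℤ) (g : K⟦n⟧ ⟶ X), J ≤ homAnnihilator R g

variable {K : T} {I J : Ideal R}

omit [∀ n : ℤ, (shiftFunctor T n).Additive] in
lemma homAnnihilated_of_retract {X Y : T} (r : Retract X Y) (hY : homAnnihilated K J Y) :
    homAnnihilated K J X := fun n g => by
  have := (hY n (g ≫ r.i)).trans (homAnnihilator_le_comp (g ≫ r.i) r.r)
  simpa using this

instance : (homAnnihilated K J).IsStableUnderRetracts := ⟨homAnnihilated_of_retract⟩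

lemma homAnnihilated_of_coproduct (hK : IsCompactObject.{w} K) {ι : Type w} {X : ι → T}
    {c : Cofan X} (hc : IsColimit c) (hX : ∀ j, homAnnihilated K J (X j)) :
    homAnnihilated K J c.pt := fun n g r hr => by
  refine (isCompactObject_shift hK n).eq_zero_of_comp_proj hc _ fun j => ?_
  rw [Linear.smul_comp]
  exact hX j n _ hr

/-- The morphisms `r • 𝟙` on shifts of `K`, with `r ∈ J`, already cut out the subcategory. The
family chosen consists of all morphisms of compacts orthogonal to it, and contains these. -/
lemma isDefinable_homAnnihilated (hK : IsCompactObject.{w} K) :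
    IsDefinable.{w} (homAnnihilated K J) := by
  refine ⟨fun A B f => IsCompactObject.{w} A ∧ IsCompactObject.{w} B ∧
    ∀ X, homAnnihilated K J X → ∀ g : B ⟶ X, f ≫ g = 0, fun A B f hf => ⟨hf.1, hf.2.1⟩,
    fun X => ⟨fun hX A B f hf g => hf.2.2 X hX g, fun hX n g r hr => ?_⟩⟩
  have := hX (r • 𝟙 (K⟦n⟧)) ⟨isCompactObject_shift hK n, isCompactObject_shift hK n,
    fun Y hY g' => ?_⟩ g
  · rwa [Linear.smul_comp, Category.id_comp] at this
  · rw [Linear.smul_comp, Category.id_comp]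
    exact hY n g' hr

section

variable [∀ n : ℤ, (shiftFunctor T n).Linear R]

lemma homAnnihilated_shift {X : T} (hX : homAnnihilated K J X) (a : ℤ) :
    homAnnihilated K J (X⟦a⟧) := fun n g r hr => by
  apply (shiftFunctor T (-a)).map_injective
  have h := hX (n + -a) ((shiftFunctorAdd T n (-a)).hom.app K ≫ g⟦-a⟧' ≫
    (shiftFunctorCompIsoId T a (-a) (by lia)).hom.app X) hr
  rw [mem_homAnnihilator, ← Linear.comp_smul, ← Linear.smul_comp, Preadditive.IsIso.comp_left_eq_zero,
    Preadditive.IsIso.comp_right_eq_zero] at h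
  rw [Functor.map_smul, h, Functor.map_zero]

lemma le_homAnnihilator_id_shift (hI : I ≤ homAnnihilator R (𝟙 K)) (n : ℤ) :
    I ≤ homAnnihilator R (𝟙 (K⟦n⟧)) := by
  simpa using hI.trans (homAnnihilator_le_map (shiftFunctor T n) (𝟙 K))

variable [HasZeroObject T] [Pretriangulated T]

omit [∀ n : ℤ, (shiftFunctor T n).Linear R] in
-- For `s ∈ J₂` the morphism `s • g` lifts to `A.obj₁`, and `J₁` kills the lift: annihilators
-- multiply along a triangle.
lemma mul_le_homAnnihilator_of_distTriang (A : Triangle T) (hA : A ∈ distTriang T) {X : T}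
    {J₁ J₂ : Ideal R} (h₁ : ∀ f : X ⟶ A.obj₁, J₁ ≤ homAnnihilator R f) (g : X ⟶ A.obj₂)
    (h₂ : J₂ ≤ homAnnihilator R (g ≫ A.mor₂)) : J₁ * J₂ ≤ homAnnihilator R g := by
  rw [Ideal.mul_le]
  intro r hr s hs
  have h : (s • g) ≫ A.mor₂ = 0 := by
    rw [Linear.smul_comp]
    exact h₂ hs
  obtain ⟨f, hf⟩ := Triangle.coyoneda_exact₂ _ hA _ h
  rw [mem_homAnnihilator, mul_smul, hf, ← Linear.smul_comp, h₁ f hr, zero_comp]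

/-- An extension is annihilated by `J ^ 2`, and also by `I`, which already acts as zero on `K`; `hJ`
then returns `J`. This is the only place where extensions need idempotency modulo `I`. -/
lemma homAnnihilated_isTriangulated (hI : I ≤ homAnnihilator R (𝟙 K)) (hJ : J ≤ J ^ 2 ⊔ I) :
    (homAnnihilated K J).IsTriangulated where
  exists_zero := ⟨_, isZero_zero T, fun n g r _ => (isZero_zero T).eq_of_tgt _ _⟩
  isStableUnderShiftBy a := ⟨fun _ hX => homAnnihilated_shift hX a⟩
  ext₂' A hA h₁ h₃ := ObjectProperty.le_isoClosure _ _ fun n g => by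
    refine hJ.trans (sup_le ?_ (le_homAnnihilator_of_id (le_homAnnihilator_id_shift hI n) g))
    rw [sq]
    exact mul_le_homAnnihilator_of_distTriang A hA (h₁ n) g (h₃ n _)

/-- If each step of a sequence has its cone in `homAnnihilated K J`, and `1 - shift` is invertible
on the coproduct of the sequence, then the sequence starts in `homAnnihilated K J`. -/
lemma homAnnihilated_of_sequence (hK : IsCompactObject.{w} K) (hI : I ≤ homAnnihilator R (𝟙 K))
    (hJ : J ≤ J ^ 2 ⊔ I) (X : ℕ → T) (t : ∀ n, X n ⟶ X (n + 1))
    (c : Cofan (fun n : ULift.{w} ℕ => X n.down)) (hc : IsColimit c) (s : c.pt ⟶ c.pt)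
    (hs : ∀ n : ℕ, c.inj ⟨n⟩ ≫ s = t n ≫ c.inj ⟨n + 1⟩) [IsIso (𝟙 c.pt - s)]
    (ht : ∀ n, (homAnnihilated K J).trW (t n)) : homAnnihilated K J (X 0) := by
  intro m g
  let k : ∀ n, K⟦m⟧ ⟶ X n := fun n => Nat.rec g (fun n f => f ≫ t n) n
  obtain ⟨N, hN⟩ := (isCompactObject_shift hK m).exists_sequence_comp_eq_zero X t c hc s hs k
    (fun _ => rfl)
  -- Going back from the stage `N` where the morphism dies, each cone costs one factor of `J`.
  have key : ∀ i j, i + j = N → J ^ j ≤ homAnnihilator R (k i) := by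
    intro i j
    induction j generalizing i with
    | zero =>
      rintro rfl r _
      rw [mem_homAnnihilator, show k i = 0 from hN, smul_zero]
    | succ j ih =>
      intro hij
      obtain ⟨Z, b, c', hT, hZ⟩ := ht i
      rw [pow_succ']
      exact mul_le_homAnnihilator_of_distTriang _ (inv_rot_of_distTriang _ hT)
        (homAnnihilated_shift hZ (-1) m) (k i) (ih (i + 1) (by lia))
  refine (le_pow_sup_of_le_sq_sup hJ N).trans (sup_le ?_
    (le_homAnnihilator_of_id (le_homAnnihilator_id_shift hI m) g))
  exact (Ideal.pow_le_pow_right (Nat.le_succ N)).trans (key 0 N (zero_add N))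

lemma isThick_homAnnihilated (hI : I ≤ homAnnihilator R (𝟙 K)) (hJ : J ≤ J ^ 2 ⊔ I) :
    IsThick (homAnnihilated K J) :=
  ⟨homAnnihilated_isTriangulated hI hJ, inferInstance⟩

end

end HomAnnihilated

/-! ### The functor `- ⊗ M`: homotopies, degreewise split sequences, coproducts -/

section TensorFunctor

variable {R : Type u} [CommRing R] (M : CochainComplex (ModuleCat.{u} R) ℤ)

open MonoidalCategory
open HomologicalComplex (ιTensorObj mapBifunctorDesc ι_mapBifunctorDesc ι_mapBifunctorMap
  mapBifunctorMapHomotopy₁ mapBifunctor.hom_ext)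

/-- The functor `- ⊗ M` on cochain complexes of modules. -/
def tensorFunctor : CochainComplex (ModuleCat.{u} R) ℤ ⥤ CochainComplex (ModuleCat.{u} R) ℤ where
  obj A := HomologicalComplex.tensorObj A M
  map f := HomologicalComplex.tensorHom f (𝟙 M)
  map_id A := ((curriedTensor (ModuleCat.{u} R)).map₂CochainComplex.flip.obj M).map_id A
  map_comp f g := ((curriedTensor (ModuleCat.{u} R)).map₂CochainComplex.flip.obj M).map_comp f g

/-- The inclusion of a summand of the tensor product of complexes. -/
def tensorι (A : CochainComplex (ModuleCat.{u} R) ℤ) (p q n : ℤ) (h : p + q = n) :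
    A.X p ⊗ M.X q ⟶ ((tensorFunctor M).obj A).X n :=
  ιTensorObj A M p q n h

variable {M} in
lemma tensorFunctor_hom_ext {A : CochainComplex (ModuleCat.{u} R) ℤ} {n : ℤ} {Y : ModuleCat.{u} R}
    {f g : ((tensorFunctor M).obj A).X n ⟶ Y}
    (h : ∀ p q (hpq : p + q = n), tensorι M A p q n hpq ≫ f = tensorι M A p q n hpq ≫ g) :
    f = g :=
  mapBifunctor.hom_ext h

/-- The morphism from a term of the tensor product of complexes given by its restrictions to the
summands. -/
def tensorDesc {A : CochainComplex (ModuleCat.{u} R) ℤ} {n : ℤ} {Y : ModuleCat.{u} R}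
    (φ : ∀ p q, p + q = n → (A.X p ⊗ M.X q ⟶ Y)) : ((tensorFunctor M).obj A).X n ⟶ Y :=
  mapBifunctorDesc (K₁ := A) (K₂ := M) (F := curriedTensor (ModuleCat.{u} R))
    (c := ComplexShape.up ℤ) φ

lemma tensorι_tensorDesc {A : CochainComplex (ModuleCat.{u} R) ℤ} {n : ℤ} {Y : ModuleCat.{u} R}
    (φ : ∀ p q, p + q = n → (A.X p ⊗ M.X q ⟶ Y)) (p q : ℤ) (h : p + q = n) :
    tensorι M A p q n h ≫ tensorDesc M φ = φ p q h :=
  ι_mapBifunctorDesc _ _ _ _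

/-- The map in degree `n` on tensor products induced by a family of maps which are not required to
commute with the differentials. -/
def tensorGradedMap {A B : CochainComplex (ModuleCat.{u} R) ℤ} (σ : ∀ p, A.X p ⟶ B.X p) (n : ℤ) :
    ((tensorFunctor M).obj A).X n ⟶ ((tensorFunctor M).obj B).X n :=
  tensorDesc M fun p q h => σ p ▷ M.X q ≫ tensorι M B p q n h

lemma ι_tensorGradedMap {A B : CochainComplex (ModuleCat.{u} R) ℤ} (σ : ∀ p, A.X p ⟶ B.X p)
    (p q n : ℤ) (h : p + q = n) :
    tensorι M A p q n h ≫ tensorGradedMap M σ n = σ p ▷ M.X q ≫ tensorι M B p q n h :=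
  tensorι_tensorDesc M _ p q h

lemma ι_tensorGradedMap_assoc {A B : CochainComplex (ModuleCat.{u} R) ℤ}
    (σ : ∀ p, A.X p ⟶ B.X p) (p q n : ℤ) (h : p + q = n) {Y : ModuleCat.{u} R}
    (φ : ((tensorFunctor M).obj B).X n ⟶ Y) :
    tensorι M A p q n h ≫ tensorGradedMap M σ n ≫ φ =
      σ p ▷ M.X q ≫ tensorι M B p q n h ≫ φ := by
  rw [← Category.assoc, ι_tensorGradedMap, Category.assoc]

lemma tensorFunctor_map_f {A B : CochainComplex (ModuleCat.{u} R) ℤ} (f : A ⟶ B) (n : ℤ) :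
    ((tensorFunctor M).map f).f n = tensorGradedMap M (fun p => f.f p) n := by
  refine tensorFunctor_hom_ext fun p q h => ?_
  rw [ι_tensorGradedMap]
  have h₁ : tensorι M A p q n h ≫ ((tensorFunctor M).map f).f n =
      f.f p ▷ M.X q ≫ B.X p ◁ (𝟙 (M.X q)) ≫ tensorι M B p q n h :=
    ι_mapBifunctorMap f (𝟙 M) (curriedTensor (ModuleCat.{u} R)) (ComplexShape.up ℤ) p q n h
  rw [h₁, whiskerLeft_id, Category.id_comp]

lemma tensorGradedMap_comp {A B C : CochainComplex (ModuleCat.{u} R) ℤ} (σ : ∀ p, A.X p ⟶ B.X p)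
    (τ : ∀ p, B.X p ⟶ C.X p) (n : ℤ) :
    tensorGradedMap M σ n ≫ tensorGradedMap M τ n =
      tensorGradedMap M (fun p => σ p ≫ τ p) n := by
  refine tensorFunctor_hom_ext fun p q h => ?_
  rw [ι_tensorGradedMap_assoc, ι_tensorGradedMap, ι_tensorGradedMap, comp_whiskerRight,
    Category.assoc]

lemma tensorGradedMap_add {A B : CochainComplex (ModuleCat.{u} R) ℤ} (σ τ : ∀ p, A.X p ⟶ B.X p)
    (n : ℤ) :
    tensorGradedMap M σ n + tensorGradedMap M τ n =
      tensorGradedMap M (fun p => σ p + τ p) n := by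
  refine tensorFunctor_hom_ext fun p q h => ?_
  rw [Preadditive.comp_add, ι_tensorGradedMap, ι_tensorGradedMap, ι_tensorGradedMap,
    MonoidalPreadditive.add_whiskerRight, Preadditive.add_comp]

lemma tensorGradedMap_id (A : CochainComplex (ModuleCat.{u} R) ℤ) (n : ℤ) :
    tensorGradedMap M (fun p => 𝟙 (A.X p)) n = 𝟙 _ := by
  refine tensorFunctor_hom_ext fun p q h => ?_
  rw [ι_tensorGradedMap, id_whiskerRight, Category.id_comp, Category.comp_id]

instance : (tensorFunctor M).Additive where
  map_add {A B f g} := by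
    ext n : 1
    rw [HomologicalComplex.add_f_apply, tensorFunctor_map_f, tensorFunctor_map_f,
      tensorFunctor_map_f, tensorGradedMap_add]
    rfl

/-- The functor `- ⊗ M` preserves homotopies. -/
def tensorFunctorMapHomotopy {A B : CochainComplex (ModuleCat.{u} R) ℤ} {f g : A ⟶ B}
    (h : Homotopy f g) : Homotopy ((tensorFunctor M).map f) ((tensorFunctor M).map g) :=
  mapBifunctorMapHomotopy₁ h (𝟙 M) _ _

/-- A degreewise splitting need not commute with the differentials, but it is still carried along by
`- ⊗ M`. Mapping cone sequences thus stay exact for arbitrary `M`. -/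
lemma tensorFunctor_shortExact {S : ShortComplex (CochainComplex (ModuleCat.{u} R) ℤ)}
    (r : ∀ p, S.X₂.X p ⟶ S.X₁.X p) (s : ∀ p, S.X₃.X p ⟶ S.X₂.X p)
    (f_r : ∀ p, S.f.f p ≫ r p = 𝟙 _) (s_g : ∀ p, s p ≫ S.g.f p = 𝟙 _)
    (id : ∀ p, r p ≫ S.f.f p + S.g.f p ≫ s p = 𝟙 _) :
    (S.map (tensorFunctor M)).ShortExact := by
  rw [HomologicalComplex.shortExact_iff_degreewise_shortExact]
  intro n
  refine ShortComplex.Splitting.shortExact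
    { r := tensorGradedMap M r n
      s := tensorGradedMap M s n
      f_r := ?_
      s_g := ?_
      id := ?_ }
  · change ((tensorFunctor M).map S.f).f n ≫ tensorGradedMap M r n = _
    rw [tensorFunctor_map_f, tensorGradedMap_comp]
    simp only [f_r]
    exact tensorGradedMap_id M _ n
  · change tensorGradedMap M s n ≫ ((tensorFunctor M).map S.g).f n = _
    rw [tensorFunctor_map_f, tensorGradedMap_comp]
    simp only [s_g]
    exact tensorGradedMap_id M _ n
  · change tensorGradedMap M r n ≫ ((tensorFunctor M).map S.f).f n +
      ((tensorFunctor M).map S.g).f n ≫ tensorGradedMap M s n = _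
    rw [tensorFunctor_map_f, tensorFunctor_map_f, tensorGradedMap_comp, tensorGradedMap_comp,
      tensorGradedMap_add]
    simp only [id]
    exact tensorGradedMap_id M _ n

section Coproducts

variable {J : Type u} {A : J → CochainComplex (ModuleCat.{u} R) ℤ} {c : Cofan A}
  (hc : IsColimit c)

/-- The summands of a tensor product with a coproduct form a coproduct. -/
def isColimitTensorCofan (p q : ℤ) :
    IsColimit (Cofan.mk (c.pt.X p ⊗ M.X q) (fun j => (c.inj j).f p ▷ M.X q)) :=
  isColimitMapCofan (HomologicalComplex.eval (ModuleCat.{u} R) (ComplexShape.up ℤ) p ⋙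
    (curriedTensor (ModuleCat.{u} R)).flip.obj (M.X q)) hc

include hc in
lemma tensorFunctor_coproduct_hom_ext {n : ℤ} {Y : ModuleCat.{u} R}
    {f g : ((tensorFunctor M).obj c.pt).X n ⟶ Y}
    (h : ∀ j, ((tensorFunctor M).map (c.inj j)).f n ≫ f =
      ((tensorFunctor M).map (c.inj j)).f n ≫ g) : f = g := by
  refine tensorFunctor_hom_ext fun p q hpq =>
    Cofan.IsColimit.hom_ext (isColimitTensorCofan M hc p q) _ _ fun j => ?_
  have := congrArg (fun φ => tensorι M (A j) p q n hpq ≫ φ) (h j)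
  simp only [tensorFunctor_map_f, ι_tensorGradedMap_assoc] at this
  exact this

/-- The morphism in degree `n` from a tensor product with a coproduct induced by a family of
morphisms. -/
def tensorCoproductDesc {n : ℤ} {Y : ModuleCat.{u} R}
    (φ : ∀ j, ((tensorFunctor M).obj (A j)).X n ⟶ Y) : ((tensorFunctor M).obj c.pt).X n ⟶ Y :=
  tensorDesc M fun p q h => Cofan.IsColimit.desc (isColimitTensorCofan M hc p q)
    (fun j => tensorι M (A j) p q n h ≫ φ j)

lemma map_inj_f_tensorCoproductDesc {n : ℤ} {Y : ModuleCat.{u} R}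
    (φ : ∀ j, ((tensorFunctor M).obj (A j)).X n ⟶ Y) (j : J) :
    ((tensorFunctor M).map (c.inj j)).f n ≫ tensorCoproductDesc M hc φ = φ j := by
  refine tensorFunctor_hom_ext fun p q hpq => ?_
  rw [tensorFunctor_map_f, ι_tensorGradedMap_assoc, tensorCoproductDesc, tensorι_tensorDesc]
  exact Cofan.IsColimit.fac (isColimitTensorCofan M hc p q) _ j

/-- The functor `- ⊗ M` preserves coproducts. -/
def isColimitTensorFunctor : IsColimit (Cofan.mk ((tensorFunctor M).obj c.pt)
    (fun j => (tensorFunctor M).map (c.inj j))) :=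
  Cofan.IsColimit.mk _
    (fun s =>
      { f := fun n => tensorCoproductDesc M hc (fun j => (s.inj j).f n)
        comm' := fun n n' _ => tensorFunctor_coproduct_hom_ext M hc fun j => by
          have h : ((tensorFunctor M).map (c.inj j)).f n ≫ ((tensorFunctor M).obj c.pt).d n n' ≫
              tensorCoproductDesc M hc (fun j => (s.inj j).f n') =
                ((tensorFunctor M).obj (A j)).d n n' ≫ (s.inj j).f n' := by
            rw [HomologicalComplex.Hom.comm_assoc, map_inj_f_tensorCoproductDesc]
          rw [← Category.assoc, map_inj_f_tensorCoproductDesc, HomologicalComplex.Hom.comm]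
          exact h.symm })
    (fun s j => by
      ext n : 1
      exact map_inj_f_tensorCoproductDesc M hc _ j)
    (fun s m hm => by
      ext n : 1
      refine tensorFunctor_coproduct_hom_ext M hc fun j => ?_
      rw [map_inj_f_tensorCoproductDesc, ← HomologicalComplex.comp_f]
      exact congrArg (fun φ => φ.f n) (hm j))

end Coproducts

end TensorFunctor

/-! ### Closure under the derived tensor product -/

section TensorIdeal

variable {R : Type u} [CommRing R] [HasDerivedCategory.{w} (ModuleCat.{u} R)]

open DerivedCategory

variable {K : DerivedCategory (ModuleCat.{u} R)} {I J : Ideal R}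
  (hK : IsCompactObject.{u} K) (hI : I ≤ homAnnihilator R (𝟙 K)) (hJ : J ≤ J ^ 2 ⊔ I)
  (M : CochainComplex (ModuleCat.{u} R) ℤ)

lemma Q_mapsTo_shift {A : CochainComplex (ModuleCat.{u} R) ℤ} (n : ℤ)
    (hA : homAnnihilated K J (Q.obj A)) : homAnnihilated K J (Q.obj (A⟦n⟧)) :=
  homAnnihilated_of_retract (Retract.ofIso ((Q.commShiftIso n).app A)) (homAnnihilated_shift hA n)

lemma homAnnihilated_tensor_shift {A : CochainComplex (ModuleCat.{u} R) ℤ} (n : ℤ)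
    (hA : homAnnihilated K J (Q.obj ((tensorFunctor M).obj A))) :
    homAnnihilated K J (Q.obj ((tensorFunctor M).obj (A⟦n⟧))) :=
  homAnnihilated_of_retract
    (Retract.ofIso (Q.mapIso (CochainComplex.mapBifunctorShift₁Iso A M _ n)))
    (Q_mapsTo_shift n hA)

variable (hM : homAnnihilated K J (Q.obj M))

include hM in
lemma homAnnihilated_tensor_cell (n : ℤ) :
    homAnnihilated K J (Q.obj ((tensorFunctor M).obj (cell R n))) := by
  have h0 : homAnnihilated K J (Q.obj ((tensorFunctor M).obj (cell R 0))) :=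
    homAnnihilated_of_retract
      (Retract.ofIso (Q.mapIso (HomologicalComplex.leftUnitor M))) hM
  have e : cell R n ≅ (cell R 0)⟦-n⟧ :=
    (((CochainComplex.singleFunctors (ModuleCat.{u} R)).shiftIso (-n) n 0 (by lia)).app
      (ModuleCat.of R R)).symm
  exact homAnnihilated_of_retract (Retract.ofIso (Q.mapIso ((tensorFunctor M).mapIso e)))
    (homAnnihilated_tensor_shift M (-n) h0)

include hK hM in
lemma homAnnihilated_tensor_cellCover (A : CochainComplex (ModuleCat.{u} R) ℤ) :
    homAnnihilated K J (Q.obj ((tensorFunctor M).obj (cellCover A))) :=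
  homAnnihilated_of_coproduct hK
    (isColimitQ (isColimitTensorFunctor M (isColimitCellCofan A)))
    (fun p => homAnnihilated_tensor_cell M hM p.1)

include hK hM in
-- The cone of a transition map is a shifted coproduct of cells. Tensored with `M` it becomes a
-- shifted coproduct of shifts of `M`, which stays in the subcategory since `K` is compact.
lemma trW_tensor_ghostTowerMap (A : CochainComplex (ModuleCat.{u} R) ℤ) (n : ℕ) :
    (homAnnihilated K J).trW (Q.map ((tensorFunctor M).map (ghostTowerMap A n))) := by
  let S := CochainComplex.mappingCone.triangleRotateShortComplex (cellCoverMap (ghostTower A n))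
  let σ := CochainComplex.mappingCone.triangleRotateShortComplexSplitting
    (cellCoverMap (ghostTower A n))
  have hS : (S.map (tensorFunctor M)).ShortExact :=
    tensorFunctor_shortExact M (fun p => (σ p).r) (fun p => (σ p).s) (fun p => (σ p).f_r)
      (fun p => (σ p).s_g) (fun p => (σ p).id)
  exact ObjectProperty.trW.mk _ (triangleOfSES_distinguished hS)
    (homAnnihilated_tensor_shift M 1 (homAnnihilated_tensor_cellCover hK M hM _))

include hK hI hJ hM in
lemma homAnnihilated_tensor (P : CochainComplex (ModuleCat.{u} R) ℤ) [P.IsKProjective] :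
    homAnnihilated K J (Q.obj (HomologicalComplex.tensorObj P M)) := by
  have hP : (ghostCofan P).pt.IsKProjective :=
    isKProjective_of_coproduct (isColimitGhostCofan P)
  let F := tensorFunctor M ⋙ Q
  -- A quasi-isomorphism between K-projective complexes is a homotopy equivalence, and these are
  -- preserved by `- ⊗ M`.
  have hF : IsIso (F.map (𝟙 _ - ghostShift P)) := by
    obtain ⟨e, he⟩ := (CochainComplex.IsKProjective.quasiIso_iff (𝟙 _ - ghostShift P)).1
      inferInstance
    refine ⟨F.map e.inv, ?_, ?_⟩
    · rw [← he, ← F.map_comp, ← F.map_id]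
      exact Q_map_eq_of_homotopy _ (tensorFunctorMapHomotopy M e.homotopyHomInvId)
    · rw [← he, ← F.map_comp, ← F.map_id]
      exact Q_map_eq_of_homotopy _ (tensorFunctorMapHomotopy M e.homotopyInvHomId)
  rw [F.map_sub, F.map_id] at hF
  have hc := isColimitQ (isColimitTensorFunctor M (isColimitGhostCofan P))
  let c : Cofan (fun n : ULift.{u} ℕ => F.obj (ghostTower P n.down)) :=
    Cofan.mk (F.obj (ghostCofan P).pt) (fun n => F.map ((ghostCofan P).inj n))
  let s : c.pt ⟶ c.pt := F.map (ghostShift P)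
  have : IsIso (𝟙 c.pt - s) := hF
  exact homAnnihilated_of_sequence hK hI hJ (fun n => F.obj (ghostTower P n))
    (fun n => F.map (ghostTowerMap P n)) c hc s
    (fun n => by
      change F.map _ ≫ _ = _ ≫ F.map _
      rw [← F.map_comp, ← F.map_comp, inj_ghostShift])
    (trW_tensor_ghostTowerMap hK M hM P)

include hK hI hJ in
lemma isDefinableTensorIdeal_homAnnihilated : IsDefinableTensorIdeal (homAnnihilated K J) where
  isThick := isThick_homAnnihilated hI hJ
  isDefinable := isDefinable_homAnnihilated hK
  tensor_mem := by
    rintro X Y Z hY ⟨P, M, hP, -, ⟨eM⟩, ⟨eZ⟩⟩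
    exact homAnnihilated_of_retract (Retract.ofIso eZ.symm) (homAnnihilated_tensor hK hI hJ M
      (homAnnihilated_of_retract (Retract.ofIso eM) hY) P)

end TensorIdeal

/-! ### Compact objects are built from cells -/

section CompactInduction

variable {T : Type u} [Category.{v} T] [Preadditive T] [HasZeroObject T] [HasShift T ℤ]
  [∀ n : ℤ, (shiftFunctor T n).Additive] [Pretriangulated T]

lemma isCompactObject_ext₁ (A : Triangle T) (hA : A ∈ distTriang T)
    (h₂ : IsCompactObject.{w} A.obj₂) (h₃ : IsCompactObject.{w} A.obj₃) :
    IsCompactObject.{w} A.obj₁ :=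
  isCompactObject_ext₂ _ (inv_rot_of_distTriang _ hA) (isCompactObject_shift h₃ (-1)) h₂

variable [IsTriangulated T] (F : ObjectProperty T) [F.IsTriangulated]

/-- Finitely many morphisms from a compact object to compact objects in a triangulated subcategory
vanish on a compact object over the source whose cone is in the subcategory. -/
lemma exists_trW_comp_eq_zero_of_finset {s : T} (hs : IsCompactObject.{w} s) {J : Type*}
    {X : J → T} (hX : ∀ j, F (X j)) (hX' : ∀ j, IsCompactObject.{w} (X j)) (S : Finset J)
    (g : ∀ j, s ⟶ X j) :
    ∃ (s' : T) (a : s' ⟶ s), IsCompactObject.{w} s' ∧ F.trW a ∧ ∀ j ∈ S, a ≫ g j = 0 := by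
  classical
  induction S using Finset.induction_on with
  | empty => exact ⟨s, 𝟙 s, hs, F.trW_of_isIso _, by simp⟩
  | insert i S _ ih =>
    obtain ⟨s', a, hs', ha, h⟩ := ih
    -- `Z` is the fibre of `a ≫ g i`, so that `b` kills this composite and has cone `X i`.
    obtain ⟨Z, b, c, hT⟩ := distinguished_cocone_triangle₁ (a ≫ g i)
    refine ⟨Z, b ≫ a, isCompactObject_ext₁ _ hT hs' (hX' i),
      F.trW.comp_mem _ _ (ObjectProperty.trW.mk _ hT (hX i)) ha, fun j hj => ?_⟩
    rw [Finset.mem_insert] at hj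
    rcases hj with rfl | hj
    · rw [Category.assoc]
      exact comp_distTriang_mor_zero₁₂ _ hT
    · rw [Category.assoc, h j hj, comp_zero]

variable [F.IsStableUnderRetracts]

omit [IsTriangulated T] [F.IsTriangulated] in
-- The target of a zero morphism is a direct summand of its cone.
lemma mem_of_trW_zero {X Y : T} (h : F.trW (0 : X ⟶ Y)) : F Y := by
  obtain ⟨Z, g, _, hT, hZ⟩ := h
  obtain ⟨r, hr⟩ := Triangle.yoneda_exact₂ _ hT (𝟙 Y) zero_comp
  exact F.prop_of_retract { i := g, r := r, retract := hr.symm } hZ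

end CompactInduction

section Derived

variable {R : Type u} [CommRing R] [HasDerivedCategory.{w} (ModuleCat.{u} R)]

open DerivedCategory

variable (F : ObjectProperty (DerivedCategory (ModuleCat.{u} R))) [F.IsTriangulated]

lemma exists_trW_comp_eq_zero_of_cellCover (hF : ∀ n, F (Q.obj (cell R n)))
    {s : DerivedCategory (ModuleCat.{u} R)} (hs : IsCompactObject.{u} s)
    (A : CochainComplex (ModuleCat.{u} R) ℤ) (g : s ⟶ Q.obj (cellCover A)) :
    ∃ (s' : DerivedCategory (ModuleCat.{u} R)) (a : s' ⟶ s), IsCompactObject.{u} s' ∧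
      F.trW a ∧ a ≫ g = 0 := by
  obtain ⟨S, h, hg⟩ := hs.exists_sum (isColimitQ (isColimitCellCofan A)) g
  obtain ⟨s', a, hs', ha, h0⟩ := exists_trW_comp_eq_zero_of_finset F hs
    (X := fun p : (Σ n : ℤ, A.cycles n) => Q.obj (cell R p.1)) (fun p => hF p.1)
    (fun p => isCompactObject_cell p.1) S h
  refine ⟨s', a, hs', ha, ?_⟩
  rw [hg, Preadditive.comp_sum]
  exact Finset.sum_eq_zero fun j hj => by rw [← Category.assoc, h0 j hj, zero_comp]

lemma IsCompactObject.exists_ghostTower_eq_zero {s : DerivedCategory (ModuleCat.{u} R)}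
    (hs : IsCompactObject.{u} s) (A : CochainComplex (ModuleCat.{u} R) ℤ)
    (k : ∀ n, s ⟶ Q.obj (ghostTower A n)) (hk : ∀ n, k (n + 1) = k n ≫ Q.map (ghostTowerMap A n)) :
    ∃ n, k n = 0 := by
  let c : Cofan (fun n : ULift.{u} ℕ => Q.obj (ghostTower A n.down)) :=
    Cofan.mk (Q.obj (ghostCofan A).pt) (fun n => Q.map ((ghostCofan A).inj n))
  let t : c.pt ⟶ c.pt := Q.map (ghostShift A)
  have h : IsIso (𝟙 c.pt - t) := by
    have : IsIso (Q.map (𝟙 _ - ghostShift A)) := inferInstance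
    rwa [Q.map_sub, Q.map_id] at this
  exact hs.exists_sequence_comp_eq_zero _ (fun n => Q.map (ghostTowerMap A n)) c
    (isColimitQ (isColimitGhostCofan A)) t (fun n => by
      change Q.map _ ≫ Q.map _ = Q.map _ ≫ Q.map _
      rw [← Q.map_comp, ← Q.map_comp, inj_ghostShift]) k hk

/-- Compact objects belong to every thick subcategory which contains the shifts of the ring. -/
theorem IsCompactObject.mem_of_cell_mem [F.IsStableUnderRetracts]
    (hF : ∀ n, F (Q.obj (cell R n))) {s : DerivedCategory (ModuleCat.{u} R)}
    (hs : IsCompactObject.{u} s) : F s := by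
  let A := Q.objPreimage s
  let k : ∀ n, s ⟶ Q.obj (ghostTower A n) := fun n =>
    Nat.rec (Q.objObjPreimageIso s).inv (fun n f => f ≫ Q.map (ghostTowerMap A n)) n
  obtain ⟨N, hN⟩ := hs.exists_ghostTower_eq_zero A k (fun _ => rfl)
  -- Induction backwards from `N`. If `a` kills `k (i + 1)`, then `a ≫ k i` lifts to a coproduct of
  -- cells; by compactness only finitely many cells matter, and they are killed at the price of a
  -- further cone in `F`.
  have key : ∀ j i, i + j = N → ∃ (s' : DerivedCategory (ModuleCat.{u} R)) (a : s' ⟶ s),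
      IsCompactObject.{u} s' ∧ F.trW a ∧ a ≫ k i = 0 := by
    intro j
    induction j with
    | zero =>
      rintro i rfl
      exact ⟨s, 𝟙 s, hs, F.trW_of_isIso _, by rw [show k i = 0 from hN, comp_zero]⟩
    | succ j ih =>
      intro i hij
      obtain ⟨s', a, hs', ha, h⟩ := ih (i + 1) (by lia)
      obtain ⟨e, he⟩ : ∃ e : s' ⟶ Q.obj (cellCover (ghostTower A i)),
          a ≫ k i = e ≫ Q.map (cellCoverMap (ghostTower A i)) := Triangle.coyoneda_exact₂ _
        (mappingCone_triangle_distinguished (cellCoverMap (ghostTower A i))) (a ≫ k i)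
        ((Category.assoc _ _ _).trans h)
      obtain ⟨s'', a', hs'', ha', h'⟩ := exists_trW_comp_eq_zero_of_cellCover F hF hs' _ e
      refine ⟨s'', a' ≫ a, hs'', F.trW.comp_mem _ _ ha' ha, ?_⟩
      rw [Category.assoc, he, ← Category.assoc, h', zero_comp]
  obtain ⟨s', a, -, ha, h⟩ := key N 0 (zero_add N)
  -- `k 0` is an isomorphism, so `a` vanishes and `s` is a summand of the cone of `a`.
  have ha0 : a = 0 := by
    rwa [← cancel_mono (Q.objObjPreimageIso s).inv, zero_comp]
  rw [ha0] at ha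
  exact mem_of_trW_zero F ha

end Derived

/-! ### Nakayama's lemma for compact objects -/

section Nakayama

variable {R : Type u} [CommRing R] [HasDerivedCategory.{w} (ModuleCat.{u} R)]

open DerivedCategory

lemma isZero_of_homology_isZero {X : DerivedCategory (ModuleCat.{u} R)}
    (h : ∀ n, IsZero ((homologyFunctor (ModuleCat.{u} R) n).obj X)) : IsZero X := by
  have hz := isZero_zero (DerivedCategory (ModuleCat.{u} R))
  have : IsIso (hz.from_ X) := by
    rw [isIso_iff]
    exact fun n => ⟨0, (h n).eq_of_src _ _, (Functor.map_isZero _ hz).eq_of_src _ _⟩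
  exact hz.of_iso (asIso (hz.from_ X))

open TStructure in
instance : (t : Triangulated.TStructure
    (DerivedCategory (ModuleCat.{u} R))).minus.IsStableUnderRetracts where
  of_retract {X Y} r := by
    rintro ⟨n, hn⟩
    refine ⟨n, ?_⟩
    change X.IsLE n
    have hY : Y.IsLE n := hn
    rw [isLE_iff] at hY ⊢
    intro i hi
    exact IsZero.of_mono ((homologyFunctor (ModuleCat.{u} R) i).map r.i) (hY i hi)

lemma IsCompactObject.exists_isLE {s : DerivedCategory (ModuleCat.{u} R)}
    (hs : IsCompactObject.{u} s) : ∃ n, s.IsLE n :=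
  hs.mem_of_cell_mem TStructure.t.minus fun n => ⟨n, inferInstance⟩

/-- A morphism from a cell to a module in the same degree is determined by an element. -/
lemma eq_zero_of_Q_map_cell_single {n : ℤ} {H : ModuleCat.{u} R}
    (g : cell R n ⟶ (HomologicalComplex.single (ModuleCat.{u} R) (ComplexShape.up ℤ) n).obj H)
    (hg : Q.map g = 0) : g = 0 := by
  obtain ⟨ψ, rfl⟩ := (HomologicalComplex.single (ModuleCat.{u} R) _ n).map_surjective g
  have : ψ = 0 := (singleFunctor (ModuleCat.{u} R) n).map_injective
    (Eq.trans hg ((singleFunctor (ModuleCat.{u} R) n).map_zero _ _).symm)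
  rw [this, Functor.map_zero]

section HomToModule

variable {A : CochainComplex (ModuleCat.{u} R) ℤ} {n : ℤ} {H H' : ModuleCat.{u} R}

/-- The morphism to a module in degree `n` given by a morphism from the term of degree `n` of a
complex which vanishes on boundaries. -/
def homToModule (φ : A.X n ⟶ H) (hφ : ∀ i, (ComplexShape.up ℤ).Rel i n → A.d i n ≫ φ = 0) :
    Q.obj A ⟶ (singleFunctor (ModuleCat.{u} R) n).obj H :=
  Q.map (HomologicalComplex.mkHomToSingle φ hφ)

lemma homToModule_comp (φ : A.X n ⟶ H)
    (hφ : ∀ i, (ComplexShape.up ℤ).Rel i n → A.d i n ≫ φ = 0) (q : H ⟶ H')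
    (hφ' : ∀ i, (ComplexShape.up ℤ).Rel i n → A.d i n ≫ φ ≫ q = 0) :
    homToModule φ hφ ≫ (singleFunctor (ModuleCat.{u} R) n).map q = homToModule (φ ≫ q) hφ' := by
  have h : HomologicalComplex.mkHomToSingle φ hφ ≫
      (HomologicalComplex.single (ModuleCat.{u} R) (ComplexShape.up ℤ) n).map q =
      HomologicalComplex.mkHomToSingle (φ ≫ q) hφ' := by
    apply HomologicalComplex.to_single_hom_ext
    simp [HomologicalComplex.single_map_f_self]
  exact (Q.map_comp _ _).symm.trans (congrArg Q.map h)

/-- In the top degree every element is a cycle, hence the image of the generator of a cell, and on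
chain maps from a cell to a module in the same degree `Q` is injective. -/
lemma eq_zero_of_homToModule [A.IsStrictlyLE n] (φ : A.X n ⟶ H)
    (hφ : ∀ i, (ComplexShape.up ℤ).Rel i n → A.d i n ≫ φ = 0)
    (h : homToModule φ hφ = 0) : φ = 0 := by
  apply ModuleCat.hom_ext
  refine LinearMap.ext fun x => ?_
  have hx : A.d n (n + 1) x = 0 := by
    have : A.d n (n + 1) = 0 := (A.isZero_of_isStrictlyLE n (n + 1) (by lia)).eq_of_tgt _ _
    rw [this]
    rfl
  have h0 := eq_zero_of_Q_map_cell_single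
    (cellHom x hx ≫ HomologicalComplex.mkHomToSingle φ hφ)
    ((Q.map_comp _ _).trans ((congrArg _ h).trans comp_zero))
  have h1 : (HomologicalComplex.mkHomToSingle φ hφ).f n x = 0 := by
    rw [← cellHom_f_cellGen x hx, ← ConcreteCategory.comp_apply, ← HomologicalComplex.comp_f, h0]
    rfl
  rw [HomologicalComplex.mkHomToSingle_f, ConcreteCategory.comp_apply] at h1
  have h2 := congrArg (HomologicalComplex.singleObjXSelf (ComplexShape.up ℤ) n H).hom h1
  rw [← ConcreteCategory.comp_apply, Iso.inv_hom_id, map_zero] at h2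
  exact h2

end HomToModule

/-- The objects all of whose morphisms to shifts of a module vanish on a quotient of the module by
a finitely generated submodule. -/
def finiteTypeProperty : ObjectProperty (DerivedCategory (ModuleCat.{u} R)) :=
  fun X => ∀ (j : ℤ) (H : ModuleCat.{u} R) (f : X ⟶ (singleFunctor (ModuleCat.{u} R) j).obj H),
    ∃ (H' : ModuleCat.{u} R) (q : H ⟶ H'), Function.Surjective q ∧ (LinearMap.ker q.hom).FG ∧
      f ≫ (singleFunctor (ModuleCat.{u} R) j).map q = 0

instance : (finiteTypeProperty (R := R)).IsStableUnderRetracts where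
  of_retract {X Y} r hY j H f := by
    obtain ⟨H', q, hq, hq', h⟩ := hY j H (r.r ≫ f)
    refine ⟨H', q, hq, hq', ?_⟩
    rw [Category.assoc] at h
    rw [← Category.id_comp f, ← r.retract, Category.assoc, Category.assoc, h, comp_zero]

instance : (finiteTypeProperty (R := R)).IsTriangulated where
  exists_zero := ⟨_, isZero_zero _, fun j H f => ⟨H, 𝟙 H, fun x => ⟨x, rfl⟩, by
    change (LinearMap.ker LinearMap.id).FG
    rw [LinearMap.ker_id]
    exact Submodule.fg_bot, (isZero_zero _).eq_of_src _ _⟩⟩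
  isStableUnderShiftBy a := ⟨fun X hX j H f => by
    let e := (singleFunctors (ModuleCat.{u} R)).shiftIso a j (j + a) (by lia)
    obtain ⟨f', hf'⟩ := (shiftFunctor _ a).map_surjective (f ≫ e.inv.app H)
    obtain ⟨H', q, hq, hq', h⟩ := hX (j + a) H f'
    refine ⟨H', q, hq, hq', ?_⟩
    rw [← cancel_mono (e.inv.app H'), zero_comp, Category.assoc, e.inv.naturality,
      ← Category.assoc, ← hf']
    change f'⟦a⟧' ≫ ((singleFunctor _ (j + a)).map q)⟦a⟧' = 0
    rw [← Functor.map_comp, h, Functor.map_zero]⟩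
  ext₂' A hA h₁ h₃ := ObjectProperty.le_isoClosure _ _ fun j H f => by
    -- The quotients are taken in turn: once `q₁` kills the restriction to `A.obj₁`, the morphism
    -- factors through `A.obj₃`, which supplies `q₂`.
    obtain ⟨H₁, q₁, hq₁, hq₁', e₁⟩ := h₁ j H (A.mor₁ ≫ f)
    obtain ⟨f', hf'⟩ := Triangle.yoneda_exact₂ _ hA (f ≫ (singleFunctor _ j).map q₁)
      ((Category.assoc _ _ _).symm.trans e₁)
    obtain ⟨H₂, q₂, hq₂, hq₂', e₂⟩ := h₃ j H₁ f'
    refine ⟨H₂, q₁ ≫ q₂, ?_, ?_, ?_⟩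
    · exact hq₂.comp hq₁
    · exact Submodule.fg_ker_comp _ _ hq₁' hq₂' hq₁
    · rw [Functor.map_comp, ← Category.assoc, hf', Category.assoc, e₂, comp_zero]

lemma finiteTypeProperty_cell (n : ℤ) : finiteTypeProperty (Q.obj (cell R n)) := by
  intro j H f
  obtain ⟨g, rfl⟩ := Q_map_surjective_of_isKProjective (cell R n)
    ((CochainComplex.singleFunctor (ModuleCat.{u} R) j).obj H) f
  by_cases hj : n = j
  · subst hj
    obtain ⟨ψ, rfl⟩ := (CochainComplex.singleFunctor (ModuleCat.{u} R) n).map_surjective g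
    let N : Submodule R H := LinearMap.range ψ.hom
    refine ⟨ModuleCat.of R (H ⧸ N), ModuleCat.ofHom N.mkQ, N.mkQ_surjective, ?_, ?_⟩
    · change (LinearMap.ker N.mkQ).FG
      rw [Submodule.ker_mkQ]
      exact Module.Finite.iff_fg.1 (Module.Finite.range (R := R) (M := R) ψ.hom)
    · refine ((singleFunctor (ModuleCat.{u} R) n).map_comp ψ _).symm.trans ?_
      have : ψ ≫ ModuleCat.ofHom N.mkQ = 0 := by
        apply ModuleCat.hom_ext
        refine LinearMap.ext fun x => ?_
        exact (Submodule.Quotient.mk_eq_zero N).2 ⟨_, rfl⟩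
      exact (congrArg _ this).trans ((singleFunctor (ModuleCat.{u} R) n).map_zero _ _)
  · refine ⟨H, 𝟙 H, fun x => ⟨x, rfl⟩, ?_, ?_⟩
    · change (LinearMap.ker LinearMap.id).FG
      rw [LinearMap.ker_id]
      exact Submodule.fg_bot
    · have : g = 0 := HomologicalComplex.from_single_hom_ext
        ((HomologicalComplex.isZero_single_obj_X (ComplexShape.up ℤ) j H n hj).eq_of_tgt _ _)
      have h : Q.map g = 0 := by rw [this, Functor.map_zero]
      exact (congrArg (· ≫ (singleFunctor (ModuleCat.{u} R) j).map (𝟙 H)) h).trans zero_comp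

/-- Applied to the projection onto the top cohomology, this gives the finite generation needed for
Nakayama's lemma. -/
lemma IsCompactObject.finiteTypeProperty {s : DerivedCategory (ModuleCat.{u} R)}
    (hs : IsCompactObject.{u} s) : finiteTypeProperty s :=
  hs.mem_of_cell_mem Telescope.finiteTypeProperty finiteTypeProperty_cell

omit [HasDerivedCategory.{w} (ModuleCat.{u} R)] in
lemma exists_surjective_residueField [IsLocalRing R] {H : ModuleCat.{u} R} [Module.Finite R H]
    (hH : ¬ IsZero H) :
    ∃ f : H ⟶ ModuleCat.of R (IsLocalRing.ResidueField R), f ≠ 0 := by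
  have : Nontrivial H := by
    by_contra h
    rw [not_nontrivial_iff_subsingleton] at h
    exact hH (ModuleCat.isZero_of_subsingleton _)
  obtain ⟨N, hN⟩ := IsCoatomic.exists_coatom (Submodule R H)
  have : IsSimpleModule R (H ⧸ N) := isSimpleModule_iff_isCoatom.2 hN
  obtain ⟨I, hI, ⟨e⟩⟩ := isSimpleModule_iff_quot_maximal.1 this
  obtain rfl := IsLocalRing.eq_maximalIdeal hI
  obtain ⟨x, hx⟩ := (e.surjective.comp N.mkQ_surjective) 1
  refine ⟨ModuleCat.ofHom (e.toLinearMap ∘ₗ N.mkQ), fun h => ?_⟩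
  have h0 : e (N.mkQ x) = 0 := congrArg (fun f => f.hom x) h
  exact one_ne_zero (α := IsLocalRing.ResidueField R) (hx.symm.trans h0)

/-- Nakayama's lemma for compact objects. -/
theorem IsCompactObject.isZero_of_residueField [IsLocalRing R]
    {s : DerivedCategory (ModuleCat.{u} R)} (hs : IsCompactObject.{u} s)
    (h : ∀ (i : ℤ) (f : s ⟶ (residueFieldObject R)⟦i⟧), f = 0) : IsZero s := by
  refine isZero_of_homology_isZero fun i => ?_
  by_contra hi
  obtain ⟨b, hb⟩ := hs.exists_isLE
  obtain ⟨n, hn, hmax⟩ := Int.exists_greatest_of_bdd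
    (P := fun i => ¬ IsZero ((homologyFunctor (ModuleCat.{u} R) i).obj s))
    ⟨b, fun z hz => not_lt.1 fun hbz => hz ((isLE_iff s b).1 hb z hbz)⟩ ⟨i, hi⟩
  have : s.IsLE n := (isLE_iff s n).2 fun i hi => not_not.1 fun h => by
    have := hmax i h
    lia
  obtain ⟨A, _, ⟨e⟩⟩ := exists_iso_Q_obj_of_isLE s n
  have hA : ∀ i, (ComplexShape.up ℤ).Rel i n → A.d i n ≫ A.pOpcycles n = 0 := fun i _ =>
    A.d_pOpcycles i n
  have hnt : ¬ IsZero (A.opcycles n) := fun hz => hn (by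
    have : IsZero (A.homology n) := IsZero.of_mono (A.homologyι n) hz
    exact this.of_iso ((homologyFunctor _ n).mapIso e ≪≫ (homologyFunctorFactors _ n).app A))
  -- Since `A` vanishes above `n`, `A.opcycles n` is the top cohomology; only the listed properties
  -- of it are retained.
  obtain ⟨H, p, hp, hnt, hp'⟩ : ∃ (H : ModuleCat.{u} R) (p : A.X n ⟶ H),
      (∀ i, (ComplexShape.up ℤ).Rel i n → A.d i n ≫ p = 0) ∧ ¬ IsZero H ∧ Epi p :=
    ⟨A.opcycles n, A.pOpcycles n, hA, hnt, inferInstance⟩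
  have hA' {H' : ModuleCat.{u} R} (q : H ⟶ H') (i) (hi : (ComplexShape.up ℤ).Rel i n) :
      A.d i n ≫ p ≫ q = 0 := by
    rw [← Category.assoc, hp i hi, zero_comp]
  have hfin : Module.Finite R H := by
    obtain ⟨H', q, hq, hq', h0⟩ := hs.finiteTypeProperty n H (e.hom ≫ homToModule p hp)
    rw [Category.assoc, Preadditive.IsIso.comp_left_eq_zero, homToModule_comp _ _ _ (hA' q)] at h0
    -- As `p` is epi, `q` itself vanishes, so its finitely generated kernel is all of `H`.
    have h1 : p ≫ q = 0 := eq_zero_of_homToModule _ _ h0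
    have h2 : q = 0 := by rwa [← cancel_epi p, comp_zero]
    rw [h2] at hq'
    refine ⟨?_⟩
    have : LinearMap.ker (0 : H →ₗ[R] H') = ⊤ := LinearMap.ker_zero
    exact this ▸ hq'
  obtain ⟨π, hπ⟩ := exists_surjective_residueField hnt
  have h1 : p ≫ π = 0 := eq_zero_of_homToModule _ (hA' π) (by
    let e' : (residueFieldObject R)⟦-n⟧ ≅ (singleFunctor (ModuleCat.{u} R) n).obj
        (ModuleCat.of R (IsLocalRing.ResidueField R)) :=
      ((singleFunctors (ModuleCat.{u} R)).shiftIso (-n) n 0 (by lia)).app _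
    have := h (-n) (e.hom ≫ homToModule _ (hA' π) ≫ e'.inv)
    rwa [Preadditive.IsIso.comp_left_eq_zero, Preadditive.IsIso.comp_right_eq_zero] at this)
  exact hπ (by rwa [← cancel_epi p, comp_zero])

end Nakayama

/-! ### Koszul complexes as iterated cones -/

section Koszul

variable {R : Type u} [CommRing R]

open CochainComplex HomComplex

lemma ofHom_smul_id (A : CochainComplex (ModuleCat.{u} R) ℤ) (x : R) :
    Cochain.ofHom (x • 𝟙 A) = x • Cochain.ofHom (𝟙 A) := by
  ext
  simp

/-- The homotopy sends the copy of `A` in the cone identically onto the shifted copy: `snd` followed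
by `inl`. -/
lemma nonempty_homotopy_mappingCone_smul_id_self (A : CochainComplex (ModuleCat.{u} R) ℤ) (x : R) :
    Nonempty (Homotopy (x • 𝟙 (mappingCone (x • 𝟙 A))) 0) := by
  refine ⟨(Cochain.equivHomotopy _ _).symm
    ⟨(mappingCone.snd (x • 𝟙 A)).comp (mappingCone.inl (x • 𝟙 A)) (zero_add (-1)), ?_⟩⟩
  rw [Cochain.ofHom_zero, add_zero, δ_comp _ _ (zero_add (-1)) 1 0 0 (by lia) (by lia) (by lia),
    mappingCone.δ_inl, mappingCone.δ_snd, ofHom_smul_id, ← mappingCone.id, Cochain.ofHom_comp]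
  simp only [ofHom_smul_id, Cochain.comp_smul, Cochain.smul_comp, Cochain.comp_id, Cochain.id_comp,
    Cochain.neg_comp, Int.negOnePow_neg, Int.negOnePow_one, Units.neg_smul, one_smul, smul_add,
    neg_neg]
  rw [add_comm]

/-- A null-homotopy `z` on `A` acts on both copies of `A` in the cone, with opposite sign on the
shifted one; with this sign the two cross terms in `x` cancel. -/
lemma nonempty_homotopy_mappingCone_smul_id (A : CochainComplex (ModuleCat.{u} R) ℤ) (x r : R)
    (h : Nonempty (Homotopy (r • 𝟙 A) 0)) :
    Nonempty (Homotopy (r • 𝟙 (mappingCone (x • 𝟙 A))) 0) := by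
  obtain ⟨h⟩ := h
  obtain ⟨z, hz⟩ := Cochain.equivHomotopy _ _ h
  rw [Cochain.ofHom_zero, add_zero, ofHom_smul_id] at hz
  have h₁ : δ (-1) 0 (z.comp (Cochain.ofHom (mappingCone.inr (x • 𝟙 A))) (add_zero (-1))) =
      r • Cochain.ofHom (mappingCone.inr (x • 𝟙 A)) := by
    rw [δ_comp_zero_cochain _ _ _ (by lia), δ_ofHom, ← hz]
    simp
  have h₂ : δ (-2) (-1) (z.comp (mappingCone.inl (x • 𝟙 A)) (show -1 + -1 = -2 by rfl)) =
      x • z.comp (Cochain.ofHom (mappingCone.inr (x • 𝟙 A))) (add_zero (-1)) -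
        r • mappingCone.inl (x • 𝟙 A) := by
    rw [δ_comp _ _ (show (-1 : ℤ) + -1 = -2 by lia) 0 0 (-1) (by lia) (by lia) (by lia),
      mappingCone.δ_inl, ← hz, Cochain.ofHom_comp, ofHom_smul_id]
    simp only [Cochain.comp_smul, Cochain.smul_comp, Cochain.id_comp, Int.negOnePow_neg,
      Int.negOnePow_one, Units.neg_smul, one_smul]
    abel
  refine ⟨(Cochain.equivHomotopy _ _).symm
    ⟨(mappingCone.snd (x • 𝟙 A)).comp
        (z.comp (Cochain.ofHom (mappingCone.inr (x • 𝟙 A))) (add_zero (-1))) (zero_add (-1)) -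
      (mappingCone.fst (x • 𝟙 A)).1.comp
        (z.comp (mappingCone.inl (x • 𝟙 A)) (show -1 + -1 = -2 by rfl)) (by lia), ?_⟩⟩
  rw [Cochain.ofHom_zero, add_zero, δ_sub,
    δ_comp _ _ (zero_add (-1)) 1 0 0 (by lia) (by lia) (by lia), h₁,
    δ_comp _ _ (show (1 : ℤ) + -2 = -1 by lia) 2 (-1) 0 (by lia) (by lia) (by lia), h₂,
    mappingCone.δ_snd, ofHom_smul_id, ← mappingCone.id, Cocycle.δ_eq_zero, ofHom_smul_id]
  simp only [Cochain.comp_smul, Cochain.smul_comp, Cochain.comp_id, Cochain.neg_comp,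
    Int.negOnePow_neg, Int.negOnePow_one, Units.neg_smul, one_smul, smul_add, neg_neg,
    Cochain.comp_sub, Cochain.zero_comp, smul_zero, add_zero]
  abel

/-- A complex over the ring `R` (in degree `0`) on which `I` acts trivially up to homotopy, and
which lies over `R ⧸ I` (in degree `0`). -/
structure IsKoszul (I : Ideal R) (A : CochainComplex (ModuleCat.{u} R) ℤ) : Prop where
  homotopy : ∀ r ∈ I, Nonempty (Homotopy (r • 𝟙 A) 0)
  exists_factorization : ∃ (i : cell R 0 ⟶ A) (p : A ⟶ (HomologicalComplex.single (ModuleCat.{u} R)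
    (ComplexShape.up ℤ) 0).obj (ModuleCat.of R (R ⧸ I))),
    i ≫ p = (HomologicalComplex.single (ModuleCat.{u} R) _ 0).map (ModuleCat.ofHom I.mkQ)

variable (R) in
lemma isKoszul_bot : IsKoszul (⊥ : Ideal R) (cell R 0) where
  homotopy r hr := by
    rw [Ideal.mem_bot] at hr
    exact ⟨Homotopy.ofEq (by rw [hr, zero_smul])⟩
  exists_factorization := ⟨𝟙 _, _, Category.id_comp _⟩

lemma IsKoszul.mappingCone {I : Ideal R} {A : CochainComplex (ModuleCat.{u} R) ℤ}
    (hA : IsKoszul I A) (x : R) :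
    IsKoszul (Ideal.span {x} ⊔ I) (mappingCone (x • 𝟙 A)) where
  homotopy r hr := by
    obtain ⟨y, hy, z, hz, rfl⟩ := Submodule.mem_sup.1 hr
    obtain ⟨a, rfl⟩ := Ideal.mem_span_singleton'.1 hy
    obtain ⟨h₁⟩ := nonempty_homotopy_mappingCone_smul_id_self A x
    obtain ⟨h₂⟩ := nonempty_homotopy_mappingCone_smul_id A x z (hA.homotopy z hz)
    rw [add_smul, mul_smul]
    exact ⟨(((h₁.smul a).add h₂).trans (Homotopy.ofEq (by simp)))⟩
  exists_factorization := by
    obtain ⟨i, p, hip⟩ := hA.exists_factorization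
    let q : ModuleCat.of R (R ⧸ I) ⟶ ModuleCat.of R (R ⧸ (Ideal.span {x} ⊔ I)) :=
      ModuleCat.ofHom (Submodule.mapQ _ _ LinearMap.id le_sup_right)
    have hq : x • q = 0 := by
      apply ModuleCat.hom_ext
      refine LinearMap.ext fun y => ?_
      obtain ⟨y, rfl⟩ := I.mkQ_surjective y
      refine (Submodule.Quotient.mk_eq_zero _).2 (Ideal.mem_sup_left ?_)
      exact Ideal.mul_mem_right _ _ (Ideal.mem_span_singleton_self x)
    let p' := p ≫ (HomologicalComplex.single (ModuleCat.{u} R) (ComplexShape.up ℤ) 0).map q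
    have hq' : x • (HomologicalComplex.single (ModuleCat.{u} R) (ComplexShape.up ℤ) 0).map q = 0 := by
      apply HomologicalComplex.to_single_hom_ext
      rw [HomologicalComplex.smul_f_apply, HomologicalComplex.single_map_f_self,
        ← Linear.comp_smul, ← Linear.smul_comp, hq, zero_comp, comp_zero]
      rfl
    have hp' : (x • 𝟙 A) ≫ p' = 0 := by
      rw [Linear.smul_comp, Category.id_comp, ← Linear.comp_smul, hq', comp_zero]
    refine ⟨i ≫ mappingCone.inr _, mappingCone.desc _ 0 p' (by simp [hp']), ?_⟩
    rw [Category.assoc, mappingCone.inr_desc, ← Category.assoc, hip, ← Functor.map_comp]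
    rfl

variable [HasDerivedCategory.{w} (ModuleCat.{u} R)]

open DerivedCategory

lemma IsKoszul.le_homAnnihilator {I : Ideal R} {A : CochainComplex (ModuleCat.{u} R) ℤ}
    (hA : IsKoszul I A) : I ≤ homAnnihilator R (𝟙 (Q.obj A)) := fun r hr => by
  obtain ⟨h⟩ := hA.homotopy r hr
  have := Q_map_eq_of_homotopy _ h
  rwa [Functor.map_smul, Functor.map_zero, CategoryTheory.Functor.map_id] at this

/-- The quotient map `R → R ⧸ I` factors through `A`, so any `r` acting as zero on `A` kills it;
evaluation at `1` gives `r ∈ I`. -/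
lemma IsKoszul.homAnnihilator_le {I : Ideal R} {A : CochainComplex (ModuleCat.{u} R) ℤ}
    (hA : IsKoszul I A) : homAnnihilator R (𝟙 (Q.obj A)) ≤ I := fun r hr => by
  obtain ⟨i, p, hip⟩ := hA.exists_factorization
  have h : r • Q.map ((HomologicalComplex.single (ModuleCat.{u} R) (.up ℤ) 0).map
      (ModuleCat.ofHom I.mkQ)) = 0 := by
    rw [← hip, Functor.map_comp, ← Category.id_comp (Q.map p), ← Linear.comp_smul,
      ← Linear.smul_comp, show r • 𝟙 (Q.obj A) = 0 from hr, zero_comp, comp_zero]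
  have h' : (DerivedCategory.singleFunctor (ModuleCat.{u} R) 0).map (r • ModuleCat.ofHom I.mkQ) =
      (DerivedCategory.singleFunctor (ModuleCat.{u} R) 0).map 0 := by
    rw [Functor.map_smul, Functor.map_zero]
    exact h
  have h'' := congrArg (fun f => f.hom (1 : R))
    ((DerivedCategory.singleFunctor (ModuleCat.{u} R) 0).map_injective h')
  have : I.mkQ (r • (1 : R)) = 0 := (I.mkQ.map_smul r 1).trans h''
  rw [smul_eq_mul, mul_one, Submodule.mkQ_apply, Submodule.Quotient.mk_eq_zero] at this
  exact this

lemma isCompactObject_Q_mappingCone {A B : CochainComplex (ModuleCat.{u} R) ℤ} (f : A ⟶ B)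
    (hA : IsCompactObject.{u} (Q.obj A)) (hB : IsCompactObject.{u} (Q.obj B)) :
    IsCompactObject.{u} (Q.obj (CochainComplex.mappingCone f)) :=
  isCompactObject_ext₂ _ (rot_of_distTriang _ (mappingCone_triangle_distinguished f)) hB
    (isCompactObject_shift hA 1)

lemma exists_isKoszul {I : Ideal R} (hI : I.FG) :
    ∃ A : CochainComplex (ModuleCat.{u} R) ℤ, IsKoszul I A ∧ IsCompactObject.{u} (Q.obj A) := by
  classical
  obtain ⟨S, rfl⟩ := hI
  induction S using Finset.induction_on with
  | empty =>
    refine ⟨cell R 0, ?_, isCompactObject_cell 0⟩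
    simpa using isKoszul_bot R
  | insert x S _ ih =>
    obtain ⟨A, hA, hA'⟩ := ih
    refine ⟨_, ?_, isCompactObject_Q_mappingCone (x • 𝟙 A) hA' hA'⟩
    rw [Finset.coe_insert, Ideal.span_insert]
    exact hA.mappingCone x

end Koszul

/-! ### Idempotent ideals from transfinite powers -/

section Transfinite

lemma transfinitePow_le_of_lt {R : Type u} [CommRing R] (m : Ideal R) {α l : Ordinal.{v}}
    (hl : Order.IsSuccLimit l) (h : α < l) : transfinitePow m l ≤ transfinitePow m α := by
  rw [transfinitePow_of_isSuccLimit m hl]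
  exact iInf_le (fun β : Set.Iio l => transfinitePow m β.1) ⟨α, h⟩

/-- If the transfinite powers of the maximal ideal do not reach zero, they become stationary at a
nonzero idempotent ideal. -/
lemma exists_idempotent_of_not_isTransfinitelySeparated (A : Type u) [CommRing A] [IsLocalRing A]
    (h : ¬ IsTransfinitelySeparated A) :
    ∃ J : Ideal A, J ≤ IsLocalRing.maximalIdeal A ∧ J ≠ ⊥ ∧ J ≤ J ^ 2 := by
  set m := IsLocalRing.maximalIdeal A
  -- The summand `1` keeps the factor positive, so that `l c` is a limit ordinal even for `c = 0`.
  let l : Ordinal.{u} → Ordinal.{u} := fun c => Ordinal.omega0 * (1 + c)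
  have hl : ∀ c, Order.IsSuccLimit (l c) := fun c =>
    Ordinal.isSuccLimit_mul_left Ordinal.isSuccLimit_omega0 (zero_lt_one.trans_le le_self_add)
  have hlt : ∀ {c c' : Ordinal.{u}}, c < c' → l c < l c' := fun hc => by
    simpa [l, mul_lt_mul_iff_right₀ Ordinal.omega0_pos] using hc
  have key : ∀ c c' : Ordinal.{u}, c < c' → transfinitePow m (l c) = transfinitePow m (l c') →
      ∃ J : Ideal A, J ≤ m ∧ J ≠ ⊥ ∧ J ≤ J ^ 2 := by
    intro c c' hc he
    refine ⟨transfinitePow m (l c), ?_, fun h0 => h ⟨_, h0⟩, ?_⟩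
    · have h1 : ((1 : ℕ) : Ordinal.{u}) < l c :=
        (Ordinal.natCast_lt_omega0 1).trans_le (Ordinal.le_mul_left _ (zero_lt_one.trans_le le_self_add))
      have := transfinitePow_le_of_lt m (hl c) h1
      rwa [transfinitePow_natCast, pow_one] at this
    -- `l c + 2` still lies below the limit `l c'`, so the square of the power at `l c` contains the
    -- power at `l c'`, which equals the power at `l c`.
    · have h2 : l c + ((2 : ℕ) : Ordinal.{u}) < l c' := (hl c').add_natCast_lt (hlt hc) 2
      have := transfinitePow_le_of_lt m (hl c') h2
      rwa [transfinitePow_add_natCast m (hl c) two_ne_zero, ← he] at this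
  -- The ordinals of a universe do not embed in the ideals of a ring of that universe, so some power
  -- repeats.
  have hinj := not_injective_of_ordinal (fun c : Ordinal.{u} => transfinitePow m (l c))
  simp only [Function.Injective, not_forall] at hinj
  obtain ⟨c, c', he, hne⟩ := hinj
  rcases lt_or_gt_of_ne hne with hc | hc
  · exact key c c' hc he
  · exact key c' c hc he.symm

/-- The ideal is the preimage of an idempotent ideal of the quotient; idempotency lifts only up to
the kernel, whence the summand `I`. -/
lemma exists_ideal_of_not_isTransfinitelySeparated {R : Type u} [CommRing R] [IsLocalRing R]
    (I : Ideal R) [IsLocalRing (R ⧸ I)] (h : ¬ IsTransfinitelySeparated (R ⧸ I)) :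
    ∃ J : Ideal R, J ≤ IsLocalRing.maximalIdeal R ∧ ¬ J ≤ I ∧ J ≤ J ^ 2 ⊔ I := by
  obtain ⟨J, hJm, hJ0, hJ⟩ := exists_idempotent_of_not_isTransfinitelySeparated _ h
  have hs : Function.Surjective (Ideal.Quotient.mk I) := Ideal.Quotient.mk_surjective
  refine ⟨J.comap (Ideal.Quotient.mk I), fun r hr => ?_, fun hJI => hJ0 ?_, ?_⟩
  · rw [IsLocalRing.mem_maximalIdeal]
    exact fun hu => (IsLocalRing.mem_maximalIdeal _).1 (hJm hr) (hu.map (Ideal.Quotient.mk I))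
  · rw [eq_bot_iff, ← Ideal.map_comap_of_surjective _ hs J, ← Ideal.map_quotient_self I]
    exact Ideal.map_mono hJI
  · have := Ideal.comap_map_of_surjective (Ideal.Quotient.mk I) hs
      ((J.comap (Ideal.Quotient.mk I)) ^ 2)
    rw [Ideal.map_pow, Ideal.map_comap_of_surjective _ hs, ← RingHom.ker_eq_comap_bot,
      Ideal.mk_ker] at this
    rw [← this]
    exact Ideal.comap_mono hJ

end Transfinite

/-! ### The residue field and the failure of compact generation -/

section TelescopeConjecture

variable {R : Type u} [CommRing R] [HasDerivedCategory.{w} (ModuleCat.{u} R)]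

open DerivedCategory

lemma maximalIdeal_le_homAnnihilator_residueFieldObject [IsLocalRing R]
    {X : DerivedCategory (ModuleCat.{u} R)} (g : X ⟶ residueFieldObject R) :
    IsLocalRing.maximalIdeal R ≤ homAnnihilator R g := fun r hr => by
  have h : r • 𝟙 (ModuleCat.of R (IsLocalRing.ResidueField R)) = 0 := by
    apply ModuleCat.hom_ext
    refine LinearMap.ext fun y => ?_
    obtain ⟨y, rfl⟩ := IsLocalRing.residue_surjective y
    change r • IsLocalRing.residue R y = 0
    rw [Algebra.smul_def, IsLocalRing.ResidueField.algebraMap_eq,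
      (IsLocalRing.residue_eq_zero_iff r).2 hr, zero_mul]
  have h' : r • 𝟙 (residueFieldObject R) = 0 := by
    have h₁ : (singleFunctor (ModuleCat.{u} R) 0).map
        (r • 𝟙 (ModuleCat.of R (IsLocalRing.ResidueField R))) = r • 𝟙 _ := by
      rw [CategoryTheory.Functor.map_smul, CategoryTheory.Functor.map_id]
    rw [h, Functor.map_zero] at h₁
    exact h₁.symm
  rw [mem_homAnnihilator, ← Category.comp_id g, ← Linear.comp_smul, h', comp_zero]

lemma homAnnihilated_residueFieldObject [IsLocalRing R] (K : DerivedCategory (ModuleCat.{u} R))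
    {J : Ideal R} (hJ : J ≤ IsLocalRing.maximalIdeal R) :
    homAnnihilated K J (residueFieldObject R) := fun _ g =>
  hJ.trans (maximalIdeal_le_homAnnihilator_residueFieldObject g)

lemma homAnnihilated_le_of_hom {T : Type u} [Category.{v} T] [Preadditive T] [HasShift T ℤ]
    [∀ n : ℤ, (shiftFunctor T n).Additive] {R : Type*} [CommRing R] [Linear R T] {K X : T}
    {J : Ideal R} (hX : homAnnihilated K J X) (g : K ⟶ X) : J ≤ homAnnihilator R g := by
  have := (hX 0 ((shiftFunctorZero T ℤ).hom.app K ≫ g)).trans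
    (homAnnihilator_le_comp' ((shiftFunctorZero T ℤ).inv.app K) _)
  simpa using this

/-- A definable ideal which contains the residue field is compactly generated only if it is the
whole derived category. -/
lemma eq_top_of_isCompactlyGenerated [IsLocalRing R]
    {D : ObjectProperty (DerivedCategory (ModuleCat.{u} R))} (hk : D (residueFieldObject R))
    (hD : IsCompactlyGenerated D) : D = ⊤ := by
  obtain ⟨S, hS, rfl⟩ := hD
  rw [eq_top_iff]
  intro X _ s hs i f
  -- Since `k` lies in `S^⊥`, Nakayama's lemma makes every object of `S` zero.
  exact ((hS.isCompactObject hs).isZero_of_residueField (fun i f => hk hs i f)).eq_of_src _ _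

/-- The object `Q.obj A` itself is missing, as shown by its identity. -/
lemma homAnnihilated_ne_top {A : CochainComplex (ModuleCat.{u} R) ℤ} {I J : Ideal R}
    (hA : IsKoszul I A) (hJI : ¬ J ≤ I) : homAnnihilated (Q.obj A) J ≠ ⊤ := fun h =>
  hJI ((homAnnihilated_le_of_hom (h ▸ trivial : homAnnihilated (Q.obj A) J (Q.obj A))
    (𝟙 _)).trans hA.homAnnihilator_le)

end TelescopeConjecture

/-! ### The cone of `x`: annihilation in terms of morphisms from `E` -/

section RestrictedTelescopeConjecture

section

variable {R : Type*} [CommRing R]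

/-- The condition that, for each `r ∈ J`, multiplication by `r` on a module kills the kernel of
multiplication by `x` and takes its values in the image of multiplication by `x`. -/
def SmulCondition (x : R) (J : Ideal R) (M : Type*) [AddCommGroup M] [Module R M] : Prop :=
  ∀ r ∈ J, ∀ m : M, (x • m = 0 → r • m = 0) ∧ ∃ m' : M, r • m = x • m'

lemma SmulCondition.of_linearEquiv {x : R} {J : Ideal R} {M N : Type*} [AddCommGroup M]
    [Module R M] [AddCommGroup N] [Module R N] (h : SmulCondition x J M) (e : M ≃ₗ[R] N) :
    SmulCondition x J N := fun r hr m => by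
  obtain ⟨m, rfl⟩ := e.surjective m
  obtain ⟨h₁, m', h₂⟩ := h r hr m
  refine ⟨fun hx => ?_, e m', ?_⟩
  · rw [← map_smul, EmbeddingLike.map_eq_zero_iff] at hx ⊢
    exact h₁ hx
  · rw [← map_smul, ← map_smul, h₂]

variable {T : Type u} [Category.{v} T] [Preadditive T] [HasShift T ℤ]
  [∀ n : ℤ, (shiftFunctor T n).Additive] [Linear R T] [∀ n : ℤ, (shiftFunctor T n).Linear R]

variable (R) in
/-- Morphisms between shifted objects. -/
def homShiftEquiv (X Y : T) (n : ℤ) : (X ⟶ Y) ≃ₗ[R] (X⟦n⟧ ⟶ Y⟦n⟧) :=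
  LinearEquiv.ofBijective ((shiftFunctor T n).mapLinearMap R)
    ⟨(shiftFunctor T n).map_injective, (shiftFunctor T n).map_surjective⟩

variable (R) in
/-- Morphisms from a shifted object, as morphisms to a shifted object. -/
def homFromShiftEquiv (X Y : T) (a b c : ℤ) (h : a + c = b) :
    (X⟦b⟧ ⟶ Y⟦c⟧) ≃ₗ[R] (X⟦a⟧ ⟶ Y) :=
  (Linear.homCongr R ((shiftFunctorAdd' T a c b h).app X) (Iso.refl _)).trans
    (homShiftEquiv R (X⟦a⟧) Y c).symm

variable {E K : T} {x : R} {J : Ideal R} [HasZeroObject T] [Pretriangulated T]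
  {i : E ⟶ K} {p : K ⟶ E⟦(1 : ℤ)⟧} (hT : Triangle.mk (x • 𝟙 E) i p ∈ distTriang T)

omit [∀ n : ℤ, (shiftFunctor T n).Linear R] in
include hT in
-- A morphism killed by `x` extends to `K`, where `r` acts as zero. The obstruction to divisibility
-- of `r • f` by `x` is a morphism from `K⟦-1⟧`, which `r` has already killed.
lemma smulCondition_of_homAnnihilated {X : T} (hX : homAnnihilated K J X) :
    SmulCondition x J (E ⟶ X) := by
  refine fun r hr f => ⟨fun hf => ?_, ?_⟩
  · obtain ⟨g, rfl⟩ : ∃ g : K ⟶ X, f = i ≫ g :=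
      Triangle.yoneda_exact₂ _ hT f (by
        change (x • 𝟙 E) ≫ f = 0
        rw [Linear.smul_comp, Category.id_comp, hf])
    rw [← Linear.comp_smul, show r • g = 0 from homAnnihilated_le_of_hom hX g hr, comp_zero]
  · obtain ⟨g, hg⟩ : ∃ g : E ⟶ X, r • f = (x • 𝟙 E) ≫ g :=
      Triangle.yoneda_exact₂ _ (inv_rot_of_distTriang _ hT) (r • f)
        ((Linear.comp_smul _ _ _ (Triangle.mk (x • 𝟙 E) i p).invRotate.mor₁ r f).trans
          (hX (-1) _ hr))
    exact ⟨g, by rw [hg, Linear.smul_comp, Category.id_comp]⟩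

omit [∀ n : ℤ, (shiftFunctor T n).Linear R] in
include hT in
-- Since `x` kills `K`, the restriction of `g` to `E` is `x`-torsion and dies under `s`. Then `s •
-- g` factors through `E⟦1⟧`, where `r` makes it divisible by `x`, which `p` kills. Two elements of
-- `J` are thus spent.
lemma smul_eq_zero_of_smulCondition (hK : x • 𝟙 K = 0) {X : T}
    (h₀ : SmulCondition x J (E ⟶ X)) (h₁ : SmulCondition x J (E⟦(1 : ℤ)⟧ ⟶ X)) (g : K ⟶ X)
    {r s : R} (hr : r ∈ J) (hs : s ∈ J) : (r * s) • g = 0 := by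
  have hi : x • i = 0 := by rw [← Category.comp_id i, ← Linear.comp_smul, hK, comp_zero]
  have hp : x • p = 0 := by rw [← Category.id_comp p, ← Linear.smul_comp, hK, zero_comp]
  have h₂ : i ≫ (s • g) = 0 := by
    rw [Linear.comp_smul]
    refine (h₀ s hs _).1 ?_
    rw [← Linear.smul_comp, hi, zero_comp]
  obtain ⟨e, he⟩ : ∃ e : E⟦(1 : ℤ)⟧ ⟶ X, s • g = p ≫ e :=
    Triangle.yoneda_exact₃ _ hT (s • g) h₂
  obtain ⟨e', he'⟩ := (h₁ r hr e).2
  rw [mul_smul, he, ← Linear.comp_smul, he', Linear.comp_smul, ← Linear.smul_comp, hp, zero_comp]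

include hT in
/-- For the cone `K` of multiplication by `x` on `E`, the objects of `homAnnihilated K J` are
characterized by their modules of morphisms from the shifts of `E`. -/
lemma homAnnihilated_iff_smulCondition (hK : x • 𝟙 K = 0) (hJ : J ≤ J ^ 2 ⊔ Ideal.span {x})
    (X : T) : homAnnihilated K J X ↔ ∀ n : ℤ, SmulCondition x J (E⟦n⟧ ⟶ X) := by
  constructor
  · intro hX n
    exact ((smulCondition_of_homAnnihilated hT (homAnnihilated_shift hX (-n))).of_linearEquiv
      (Linear.homCongr R ((shiftFunctorZero T ℤ).symm.app E) (Iso.refl _))).of_linearEquiv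
      (homFromShiftEquiv R E X n 0 (-n) (by lia))
  · intro h n g
    let ε : (K ⟶ X⟦-n⟧) ≃ₗ[R] (K⟦n⟧ ⟶ X) :=
      (Linear.homCongr R ((shiftFunctorZero T ℤ).symm.app K) (Iso.refl _)).trans
        (homFromShiftEquiv R K X n 0 (-n) (by lia))
    obtain ⟨g, rfl⟩ := ε.surjective g
    refine hJ.trans (sup_le ?_ ?_)
    · rw [sq, Ideal.mul_le]
      intro r hr s hs
      have h₀ := ((h n).of_linearEquiv (homFromShiftEquiv R E X n 0 (-n) (by lia)).symm).of_linearEquiv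
        (Linear.homCongr R ((shiftFunctorZero T ℤ).app E) (Iso.refl _))
      have h₁ := (h (n + 1)).of_linearEquiv (homFromShiftEquiv R E X (n + 1) 1 (-n) (by lia)).symm
      rw [mem_homAnnihilator, ← map_smul, smul_eq_zero_of_smulCondition hT hK h₀ h₁ g hr hs,
        map_zero]
    · rw [Ideal.span_singleton_le_iff_mem, mem_homAnnihilator, ← map_smul,
        ← Category.id_comp g, ← Linear.smul_comp, hK, zero_comp, map_zero]

end

end RestrictedTelescopeConjecture

/-! ### From morphisms out of cells to cohomology modules -/

section CohomologyCondition

variable {R : Type u} [CommRing R]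

/-- The morphism from a cell given by a cycle, as a linear map. -/
def cellHomLinear (B : CochainComplex (ModuleCat.{u} R) ℤ) (n : ℤ) :
    B.cycles n →ₗ[R] (cell R n ⟶ B) where
  toFun z := cellHom (B.iCycles n z) (d_iCycles_apply B n z)
  map_add' z z' := cell_hom_ext (by
    rw [cellHom_f_cellGen, map_add]
    exact (congrArg₂ (· + ·) (cellHom_f_cellGen _ (d_iCycles_apply B n z))
      (cellHom_f_cellGen _ (d_iCycles_apply B n z'))).symm)
  map_smul' r z := cell_hom_ext (by
    rw [cellHom_f_cellGen, map_smul]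
    exact congrArg (r • ·) (cellHom_f_cellGen _ (d_iCycles_apply B n z)).symm)

lemma cellHomLinear_f_cellGen (B : CochainComplex (ModuleCat.{u} R) ℤ) (n : ℤ) (z : B.cycles n) :
    (cellHomLinear B n z).f n (cellGen n) = B.iCycles n z :=
  cellHom_f_cellGen _ (d_iCycles_apply B n z)

lemma cellHomLinear_surjective (B : CochainComplex (ModuleCat.{u} R) ℤ) (n : ℤ) :
    Function.Surjective (cellHomLinear B n) := fun g => by
  obtain ⟨u, hu⟩ := exists_cellGen_cycle (R := R) n
  refine ⟨HomologicalComplex.cyclesMap g n u, cell_hom_ext ?_⟩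
  rw [cellHomLinear_f_cellGen, ← ConcreteCategory.comp_apply, HomologicalComplex.cyclesMap_i,
    ConcreteCategory.comp_apply, hu]

lemma exists_d_eq_of_homologyπ_eq_zero {B : CochainComplex (ModuleCat.{u} R) ℤ} {n : ℤ}
    {z : B.cycles n} (hz : B.homologyπ n z = 0) :
    ∃ y : B.X (n - 1), B.d (n - 1) n y = B.iCycles n z := by
  have hex : (ShortComplex.mk (B.toCycles (n - 1) n) (B.homologyπ n)
      (B.toCycles_comp_homologyπ _ _)).Exact :=
    ShortComplex.exact_of_g_is_cokernel _ (B.homologyIsCokernel (n - 1) n (by simp))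
  obtain ⟨y, hy⟩ := (ShortComplex.moduleCat_exact_iff _).1 hex z hz
  refine ⟨y, ?_⟩
  rw [← hy]
  change _ = (B.toCycles (n - 1) n ≫ B.iCycles n) y
  rw [HomologicalComplex.toCycles_i]

/-- A morphism from a cell to a boundary is null-homotopic. -/
lemma nonempty_homotopy_zero_of_cellGen_eq_d {B : CochainComplex (ModuleCat.{u} R) ℤ} {n : ℤ}
    (g : cell R n ⟶ B) (y : B.X (n - 1)) (hy : B.d (n - 1) n y = g.f n (cellGen n)) :
    Nonempty (Homotopy g 0) := by
  let φ : ModuleCat.of R R ⟶ B.X (n - 1) := ModuleCat.ofHom (LinearMap.toSpanSingleton R _ y)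
  let z : CochainComplex.HomComplex.Cochain
      ((CochainComplex.singleFunctor (ModuleCat.{u} R) n).obj (ModuleCat.of R R)) B (-1) :=
    CochainComplex.HomComplex.Cochain.fromSingleMk φ (show n + -1 = n - 1 by lia)
  refine ⟨(CochainComplex.HomComplex.Cochain.equivHomotopy g 0).symm ⟨z, ?_⟩⟩
  have hz : CochainComplex.HomComplex.δ (-1) 0 z =
      CochainComplex.HomComplex.Cochain.fromSingleMk (φ ≫ B.d (n - 1) n) (add_zero n) :=
    CochainComplex.HomComplex.Cochain.δ_fromSingleMk _ _ _ _ _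
  have hg : CochainComplex.HomComplex.Cochain.fromSingleMk (φ ≫ B.d (n - 1) n) (add_zero n) =
      CochainComplex.HomComplex.Cochain.ofHom
        (F := (CochainComplex.singleFunctor (ModuleCat.{u} R) n).obj (ModuleCat.of R R)) g := by
    apply (CochainComplex.HomComplex.Cochain.fromSingleEquiv (add_zero n)).injective
    rw [CochainComplex.HomComplex.Cochain.fromSingleEquiv_fromSingleMk]
    apply ModuleCat.hom_ext
    apply LinearMap.ext_ring
    refine (congrArg (B.d (n - 1) n) (one_smul R y)).trans (hy.trans ?_)
    change _ = (CochainComplex.HomComplex.Cochain.ofHom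
      (F := (CochainComplex.singleFunctor (ModuleCat.{u} R) n).obj (ModuleCat.of R R)) g).v n n
        (add_zero n) (cellGen n)
    exact congrArg (fun f => f.hom (cellGen n))
      (CochainComplex.HomComplex.Cochain.ofHom_v (F := (CochainComplex.singleFunctor
        (ModuleCat.{u} R) n).obj (ModuleCat.of R R)) g n).symm
  rw [CochainComplex.HomComplex.Cochain.ofHom_zero, add_zero]
  exact (hz.trans hg).symm

variable [HasDerivedCategory.{w} (ModuleCat.{u} R)]

open DerivedCategory

lemma Q_map_cellHomLinear_eq_zero_iff (B : CochainComplex (ModuleCat.{u} R) ℤ) (n : ℤ)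
    (z : B.cycles n) : Q.map (cellHomLinear B n z) = 0 ↔ B.homologyπ n z = 0 := by
  constructor
  · intro h
    have h₁ : HomologicalComplex.homologyMap (cellHomLinear B n z) n = 0 := by
      have h₂ := (homologyFunctorFactors (ModuleCat.{u} R) n).hom.naturality (cellHomLinear B n z)
      rw [Functor.comp_map, h, Functor.map_zero, zero_comp, eq_comm,
        Preadditive.IsIso.comp_left_eq_zero] at h₂
      exact h₂
    obtain ⟨u, hu⟩ := exists_cellGen_cycle (R := R) n
    have h₃ : HomologicalComplex.cyclesMap (cellHomLinear B n z) n u = z := by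
      apply iCycles_injective
      rw [← ConcreteCategory.comp_apply, HomologicalComplex.cyclesMap_i,
        ConcreteCategory.comp_apply, hu, cellHomLinear_f_cellGen]
    rw [← h₃, ← ConcreteCategory.comp_apply, ← HomologicalComplex.homologyπ_naturality, h₁,
      comp_zero]
    rfl
  · intro h
    obtain ⟨y, hy⟩ := exists_d_eq_of_homologyπ_eq_zero h
    obtain ⟨H⟩ := nonempty_homotopy_zero_of_cellGen_eq_d (cellHomLinear B n z) y
      (hy.trans (cellHomLinear_f_cellGen B n z).symm)
    rw [Q_map_eq_of_homotopy _ H, Functor.map_zero]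

/-- Cohomology is represented by cells. -/
lemma nonempty_cell_hom_linearEquiv (X : DerivedCategory (ModuleCat.{u} R)) (n : ℤ) :
    Nonempty ((Q.obj (cell R n) ⟶ X) ≃ₗ[R] (homologyFunctor (ModuleCat.{u} R) n).obj X) := by
  let B := Q.objPreimage X
  let f : B.cycles n →ₗ[R] (Q.obj (cell R n) ⟶ Q.obj B) :=
    (Q.mapLinearMap R).comp (cellHomLinear B n)
  have hf : Function.Surjective f :=
    (Q_map_surjective_of_isKProjective (cell R n) B).comp (cellHomLinear_surjective B n)
  have hker : LinearMap.ker f = LinearMap.ker (B.homologyπ n).hom := by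
    ext z
    exact Q_map_cellHomLinear_eq_zero_iff B n z
  let e : (Q.obj (cell R n) ⟶ Q.obj B) ≃ₗ[R] B.homology n :=
    (f.quotKerEquivOfSurjective hf).symm.trans ((Submodule.quotEquivOfEq _ _ hker).trans
      ((B.homologyπ n).hom.quotKerEquivOfSurjective (homologyπ_surjective B n)))
  exact ⟨(Linear.homCongr R (Iso.refl _) (Q.objObjPreimageIso X).symm).trans (e.trans
    (((homologyFunctorFactors (ModuleCat.{u} R) n).symm.app B ≪≫
      (homologyFunctor (ModuleCat.{u} R) n).mapIso (Q.objObjPreimageIso X)).toLinearEquiv))⟩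

omit [HasDerivedCategory.{w} (ModuleCat.{u} R)] in
lemma SmulCondition.of_coproduct {x : R} {J : Ideal R} {ι : Type*} {X : ι → ModuleCat.{u} R}
    {c : Cofan X} (hc : IsColimit c) (h : ∀ j, SmulCondition x J (X j)) :
    SmulCondition x J c.pt := by
  classical
  intro r hr m
  obtain ⟨F, g, rfl⟩ := exists_sum_inj_apply hc m
  refine ⟨fun hx => ?_, ?_⟩
  · rw [Finset.smul_sum]
    refine Finset.sum_eq_zero fun j hj => ?_
    rw [← map_smul]
    suffices r • g j = 0 by rw [this, map_zero]
    refine (h j r hr _).1 ?_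
    have := congrArg (coproductProj hc j) hx
    rw [map_zero, map_smul, map_sum, Finset.sum_eq_single_of_mem j hj] at this
    · rwa [← ConcreteCategory.comp_apply, inj_coproductProj_self] at this
    · intro i _ hi
      rw [← ConcreteCategory.comp_apply, inj_coproductProj_of_ne hc hi]
      rfl
  · choose g' hg' using fun j => (h j r hr (g j)).2
    refine ⟨∑ j ∈ F, c.inj j (g' j), ?_⟩
    rw [Finset.smul_sum, Finset.smul_sum]
    exact Finset.sum_congr rfl fun j _ => by rw [← map_smul, ← map_smul, hg']

variable {x : R} {J : Ideal R} (hJ : J ≤ J ^ 2 ⊔ Ideal.span {x})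

include hJ in
-- Shifts of `R` represent cohomology, so membership depends on `X` only through its cohomology
-- modules.
lemma homAnnihilated_iff_smulCondition_homology (X : DerivedCategory (ModuleCat.{u} R)) :
    homAnnihilated (Q.obj (CochainComplex.mappingCone (x • 𝟙 (cell R 0)))) J X ↔
      ∀ n : ℤ, SmulCondition x J ((homologyFunctor (ModuleCat.{u} R) n).obj X) := by
  have hK : x • 𝟙 (Q.obj (CochainComplex.mappingCone (x • 𝟙 (cell R 0)))) = 0 :=
    ((isKoszul_bot R).mappingCone x).le_homAnnihilator
      (Ideal.mem_sup_left (Ideal.mem_span_singleton_self x))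
  have hT := mappingCone_triangle_distinguished (x • 𝟙 (cell R 0))
  have hx : Q.map (x • 𝟙 (cell R 0)) = x • 𝟙 (Q.obj (cell R 0)) := by
    rw [CategoryTheory.Functor.map_smul, CategoryTheory.Functor.map_id]
  have hT' : Triangle.mk (x • 𝟙 (Q.obj (cell R 0)))
      (Q.map (CochainComplex.mappingCone.inr (x • 𝟙 (cell R 0))))
      (Q.mapTriangle.obj (CochainComplex.mappingCone.triangle (x • 𝟙 (cell R 0)))).mor₃ ∈
        distTriang (DerivedCategory (ModuleCat.{u} R)) := by
    rw [← hx]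
    exact hT
  rw [homAnnihilated_iff_smulCondition hT' hK hJ]
  have e (n : ℤ) : (Q.obj (cell R 0))⟦n⟧ ≅ Q.obj (cell R (-n)) :=
    ((singleFunctors (ModuleCat.{u} R)).shiftIso n (-n) 0 (by lia)).app (ModuleCat.of R R)
  constructor
  · intro h n
    obtain ⟨e'⟩ := nonempty_cell_hom_linearEquiv X n
    refine (((h (-n)).of_linearEquiv (Linear.homCongr R (e (-n)) (Iso.refl X)))).of_linearEquiv ?_
    rw [neg_neg]
    exact e'
  · intro h n
    obtain ⟨e'⟩ := nonempty_cell_hom_linearEquiv X (-n)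
    exact ((h (-n)).of_linearEquiv e'.symm).of_linearEquiv
      (Linear.homCongr R (e n).symm (Iso.refl X))

include hJ in
lemma isClosedUnderCohomology_homAnnihilated : IsClosedUnderCohomology
    (homAnnihilated (Q.obj (CochainComplex.mappingCone (x • 𝟙 (cell R 0)))) J) := by
  intro X hX
  rw [homAnnihilated_iff_smulCondition_homology hJ] at hX ⊢
  intro n
  by_cases hn : n = 0
  · subst hn
    have h : SmulCondition x J (∐ fun n : ℤ => (homologyFunctor (ModuleCat.{u} R) n).obj X :
        ModuleCat.{u} R) :=
      SmulCondition.of_coproduct (coproductIsCoproduct _) hX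
    exact h.of_linearEquiv
      ((singleFunctorCompHomologyFunctorIso (ModuleCat.{u} R) 0).symm.app _).toLinearEquiv
  · have hz : IsZero ((homologyFunctor (ModuleCat.{u} R) n).obj ((singleFunctor _ 0).obj
        (∐ fun n : ℤ => (homologyFunctor (ModuleCat.{u} R) n).obj X))) := by
      rcases lt_or_gt_of_ne hn with h | h
      · exact isZero_of_isGE _ 0 n h
      · exact isZero_of_isLE _ 0 n h
    have := ModuleCat.subsingleton_of_isZero hz
    exact fun r _ m => ⟨fun _ => Subsingleton.elim _ _, 0, Subsingleton.elim _ _⟩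

end CohomologyCondition

end Telescope

end

theorem lemma6p7 {R : Type u} [CommRing R] [IsLocalRing R]
    [HasDerivedCategory.{w} (ModuleCat.{u} R)]
    (I : Ideal R) (hI : I.FG) [IsLocalRing (R ⧸ I)]
    (hsep : ¬ Telescope.IsTransfinitelySeparated (R ⧸ I)) :
    Telescope.definableClosure (ObjectProperty.singleton (Telescope.residueFieldObject R)) ≠ ⊤ ∧
      ¬ Telescope.TelescopeConjecture R ∧
      (∀ x ∈ nonZeroDivisors R, I = Ideal.span {x} →
        ¬ Telescope.RestrictedTelescopeConjecture R) := by
  obtain ⟨J, hJm, hJI, hJ⟩ := Telescope.exists_ideal_of_not_isTransfinitelySeparated I hsep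
  obtain ⟨A, hA, hA'⟩ := Telescope.exists_isKoszul hI
  have hD := Telescope.isDefinableTensorIdeal_homAnnihilated hA' hA.le_homAnnihilator hJ
  have hk := Telescope.homAnnihilated_residueFieldObject (DerivedCategory.Q.obj A) hJm
  have htop := Telescope.homAnnihilated_ne_top hA hJI
  refine ⟨fun h => htop ?_, fun h => htop
    (Telescope.eq_top_of_isCompactlyGenerated hk (h _ hD)), ?_⟩
  · rw [eq_top_iff, ← h]
    exact Telescope.definableClosure_le hD (by simpa using hk)
  -- The Koszul complex is now taken to be the cone of `x` on `R` itself, to which the cohomological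
  -- criterion applies.
  · rintro x - rfl h
    have hx := (Telescope.isKoszul_bot R).mappingCone x
    rw [sup_bot_eq] at hx
    exact Telescope.homAnnihilated_ne_top hx hJI (Telescope.eq_top_of_isCompactlyGenerated
      (Telescope.homAnnihilated_residueFieldObject _ hJm) (h _
        (Telescope.isDefinableTensorIdeal_homAnnihilated
          (Telescope.isCompactObject_Q_mappingCone _ (Telescope.isCompactObject_cell 0)
            (Telescope.isCompactObject_cell 0))
          hx.le_homAnnihilator hJ)
        (Telescope.isClosedUnderCohomology_homAnnihilated hJ)))
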